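/- A germ of a holomorphic foliation of $\mathbb{C}^2$ with an isolated singularity at $0$ is represented by a pair $[U,\theta]$, where $U$ is an open neighbourhood of $0$ and $\theta$ is a holomorphic vector field on $U$ vanishing exactly at $0$; multiplying $\theta$ by a nowhere vanishing holomorphic function does not change the germ. The leaves in an open set are the maximal connected complex integral curves of $\theta$ there. Two germs $[U,\theta]$, $[U',\theta']$ are topologically equivalent if there is a homeomorphism $\phi:V\to V'$ of open neighbourhoods $V\subset U$, $V'\subset U'$ of $0$ with $\phi(0)=0$ which maps the leaves in $V$ onto the leaves in $V'$. Consider the following four cases of germs of Poincaré type, represented by the following vector fields: 1. (non-real ratio) $\lambda x\,\partial_x+y\,\partial_y$ with $\lambda\in\mathbb{C}\setminus\mathbb{R}$; 2. (resonant) $(mx+y^m)\,\partial_x+y\,\partial_y$ with $m\ge 1$ an integer; 3. (rational non-resonant) $\lambda x\,\partial_x+y\,\partial_y$ with $\lambda\in\mathbb{Q}_{>0}$; 4. (irrational real ratio) $\lambda x\,\partial_x+y\,\partial_y$ with $\lambda\in\mathbb{R}_{>0}\setminus\mathbb{Q}$. **Theorem.** The topological equivalence classes found in the four cases are pairwise distinct: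 two germs belonging to two different cases are never topologically equivalent. Likewise, let the trace foliation of one of these vector fields be the real one-dimensional foliation that its leaves cut out on the unit sphere $S^3\subset\mathbb{C}^2$. For vector fields from two different cases there is no homeomorphism of $S^3$ mapping the leaves of one trace foliation onto the leaves of the other. The closed leaves and the leaf closures of the trace foliation are as follows. 1. In case 1 the closed leaves are exactly $\{x=0\}\cap S^3$ and $\{y=0\}\cap S^3$, and the closure of any other leaf is the union of that leaf and these two closed leaves. 2. In case 2 the only closed leaf is $\{y=0\}\cap S^3$, and the closure of any other leaf is the union of that leaf and this closed leaf. 3. In case 3 every leaf is closed. 4. In case 4 the closed leaves are exactly $\{x=0\}\cap S^3$ and $\{y=0\}\cap S^3$, and the closure of the leaf through any other point $(a,b)$ is the torus $\{(x,y)\in S^3: |x|=|a|\}$. -/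

import Mathlib

/-- A representative `[U, θ]` of a germ of holomorphic foliation of rank one in `ℂ²` with an
isolated singularity at the origin: `U` is an open neighbourhood of `0` and `θ` is a holomorphic
vector field on `U` that vanishes exactly at `0`. The pair `(f₁, f₂)` stands for the vector field
`f₁ ∂/∂x + f₂ ∂/∂y`. -/
structure PlaneGerm where
  /-- The domain of the vector field. -/
  U : Set (ℂ × ℂ)
  isOpen_U : IsOpen U
  zero_mem : (0 : ℂ × ℂ) ∈ U
  /-- The vector field; only its values on `U` matter. -/
  θ : ℂ × ℂ → ℂ × ℂ
  holomorphic : DifferentiableOn ℂ θ U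
  zeros : ∀ p ∈ U, θ p = 0 ↔ p = 0

/-- The leaf through `p` of the foliation that the complex line field `ℂ · θ` induces on `A`: all
endpoints of continuously differentiable curves in `A` that start at `p` and whose velocity is
everywhere a complex multiple of `θ`.

* If `A` is an open set, this is the leaf (maximal connected integral curve) through `p` of the
  holomorphic foliation given by `θ` on `A`; the leaf of a zero of `θ` is that point.
* If `A` is a sphere transversal to the foliation, the curve is tangent both to `A` and to
  `ℂ · θ`, hence to the real line field `TA ∩ ℂ · θ`, and this is the leaf through `p` of the real
  intersection foliation on `A`. -/
def leafIn (θ : ℂ × ℂ → ℂ × ℂ) (A : Set (ℂ × ℂ)) (p : ℂ × ℂ) : Set (ℂ × ℂ) :=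
  {q | ∃ (γ : ℝ → ℂ × ℂ) (c : ℝ → ℂ), Continuous c ∧ (∀ t, γ t ∈ A) ∧
    (∀ t, HasDerivAt γ (c t • θ (γ t)) t) ∧ γ 0 = p ∧ γ 1 = q}

/-- Topological equivalence of germs: a homeomorphism `φ : V → V'` between open neighbourhoods
`V ⊆ U`, `V' ⊆ U'` of `0`, with `φ 0 = 0`, that maps the leaves of the first foliation in `V` onto
the leaves of the second foliation in `V'`. -/
def PlaneGerm.TopEquiv (F G : PlaneGerm) : Prop :=
  ∃ φ : OpenPartialHomeomorph (ℂ × ℂ) (ℂ × ℂ),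
    (0 : ℂ × ℂ) ∈ φ.source ∧ φ 0 = 0 ∧ φ.source ⊆ F.U ∧ φ.target ⊆ G.U ∧
    ∀ p ∈ φ.source, φ '' leafIn F.θ φ.source p = leafIn G.θ φ.target (φ p)

/-- The vector field `l x ∂/∂x + y ∂/∂y`. -/
def linearField (l : ℂ) : ℂ × ℂ → ℂ × ℂ := fun p => (l * p.1, p.2)

/-- The vector field `(m x + y ^ m) ∂/∂x + y ∂/∂y`. -/
def resonantField (m : ℕ) : ℂ × ℂ → ℂ × ℂ := fun p => ((m : ℂ) * p.1 + p.2 ^ m, p.2)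

/-- The four cases of the classification of plane germs of Poincaré type. -/
inductive PoincareCase
  | nonReal
  | resonant
  | rational
  | irrational

/-- The normal forms that make up each of the four cases. -/
def PoincareCase.normalForms : PoincareCase → Set (ℂ × ℂ → ℂ × ℂ)
  | .nonReal => {θ | ∃ l : ℂ, l.im ≠ 0 ∧ θ = linearField l}
  | .resonant => {θ | ∃ m : ℕ, 1 ≤ m ∧ θ = resonantField m}
  | .rational => {θ | ∃ r : ℚ, 0 < r ∧ θ = linearField (r : ℂ)}
  | .irrational => {θ | ∃ r : ℝ, 0 < r ∧ Irrational r ∧ θ = linearField (r : ℂ)}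

/-- The foliation given by `F` is represented on its domain by the vector field `η`: the vector
field of `F` is `h · η` for a nowhere vanishing holomorphic function `h` on the domain. -/
def PlaneGerm.RepresentedBy (F : PlaneGerm) (η : ℂ × ℂ → ℂ × ℂ) : Prop :=
  ∃ h : ℂ × ℂ → ℂ, DifferentiableOn ℂ h F.U ∧ (∀ p ∈ F.U, h p ≠ 0) ∧
    ∀ p ∈ F.U, F.θ p = h p • η p

/-- The germ `F` belongs to the case `i`. -/
def PlaneGerm.InCase (F : PlaneGerm) (i : PoincareCase) : Prop :=
  ∃ η ∈ i.normalForms, F.RepresentedBy η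

/-- The Euclidean unit sphere `S³` in `ℂ²`. -/
def sphere3 : Set (ℂ × ℂ) := {p | ‖p.1‖ ^ 2 + ‖p.2‖ ^ 2 = 1}

/-- The leaf through `p` of the trace foliation (real intersection foliation) on `S³`. -/
def traceLeaf (θ : ℂ × ℂ → ℂ × ℂ) (p : sphere3) : Set sphere3 :=
  {q | (q : ℂ × ℂ) ∈ leafIn θ sphere3 p}

/-- The closed leaves of the trace foliation on `S³`. -/
def closedTraceLeaves (θ : ℂ × ℂ → ℂ × ℂ) : Set (Set sphere3) :=
  {L | L ∈ Set.range (traceLeaf θ) ∧ IsClosed L}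

/-- Topological equivalence of trace foliations: a homeomorphism of `S³` mapping the leaves of the
first onto the leaves of the second. -/
def TraceEquiv (θ η : ℂ × ℂ → ℂ × ℂ) : Prop :=
  ∃ φ : sphere3 ≃ₜ sphere3, ∀ p, φ '' traceLeaf θ p = traceLeaf η (φ p)

/-- The circle `{x = 0} ∩ S³`. -/
def circleX : Set sphere3 := {q | (q : ℂ × ℂ).1 = 0}

/-- The circle `{y = 0} ∩ S³`. -/
def circleY : Set sphere3 := {q | (q : ℂ × ℂ).2 = 0}

open Filter Topology Set

/-! ### Leaves as equivalence classes -/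

/-! Integrating the velocity factor `c` shows that every leaf lies in one orbit of the complex flow
of the normal form, and orbit points lie on one leaf of `A` as soon as their times are joined by a
C¹ path that the flow keeps in `A` (`mem_leafIn_of_flow`). Leaves are thus studied in the complex
time plane.

For germs, closedness of a leaf in `V \ {0}` is a topological property, and it yields three
invariants. All leaves are closed in the rational case, because of the first integral `x ^ n / y ^
k`, and in no other case. In the resonant case only the leaf in `y = 0` is closed near `0`, while
linear fields have both axes closed. The non-real and irrational cases are told apart by closures:
for non-real `λ` every leaf off the axes accumulates on `y = 0` (`mk_zero_mem_closure_leafIn`),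
whereas for irrational `λ` it stays on a level set of `|x| / |y| ^ λ`, which meets the axes only at
`0`, and winds densely in tori there.

On the sphere, the times at which a flow line lies in `S³` form a line or a single C¹ curve, so a
trace leaf is the whole intersection of an orbit with `S³`. Following this curve to infinity gives
the closures: one modulus tends to `0`, the other to `1`, and the phase of the surviving coordinate
is unbounded, so the leaf accumulates on an entire circle. Nothing else is added, since off the
limit circles the time is a continuous function of the point. For real `λ` the time set is a line,
and the leaf is periodic or dense in a torus. The same three kinds of invariants then separate the
trace foliations. -/

theorem mem_leafIn_self {θ : ℂ × ℂ → ℂ × ℂ} {A : Set (ℂ × ℂ)} {p : ℂ × ℂ} (hp : p ∈ A) :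
    p ∈ leafIn θ A p :=
  ⟨fun _ => p, fun _ => 0, continuous_const, fun _ => hp,
    fun t => by simpa using hasDerivAt_const t p, rfl, rfl⟩

theorem leafIn_subset {θ : ℂ × ℂ → ℂ × ℂ} {A : Set (ℂ × ℂ)} {p : ℂ × ℂ} : leafIn θ A p ⊆ A := by
  rintro q ⟨γ, c, -, hA, -, -, rfl⟩
  exact hA 1

theorem mem_leafIn_symm {θ : ℂ × ℂ → ℂ × ℂ} {A : Set (ℂ × ℂ)} {p q : ℂ × ℂ}
    (h : q ∈ leafIn θ A p) : p ∈ leafIn θ A q := by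
  obtain ⟨γ, c, hc, hA, hγ, h0, h1⟩ := h
  refine ⟨fun t => γ (1 - t), fun t => -c (1 - t), by fun_prop, fun t => hA _, fun t => ?_,
    by simpa using h1, by simpa using h0⟩
  have h2 : HasDerivAt (fun t : ℝ => 1 - t) (-1) t := by
    simpa using (hasDerivAt_id t).const_sub 1
  exact ((hγ (1 - t)).scomp t h2).congr_deriv (by simp)

theorem Real.smoothTransition_hasDerivAt (t : ℝ) :
    HasDerivAt Real.smoothTransition (deriv Real.smoothTransition t) t :=
  (Real.smoothTransition.contDiff (n := 1)).differentiable one_ne_zero t |>.hasDerivAt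

theorem Real.continuous_deriv_smoothTransition : Continuous (deriv Real.smoothTransition) :=
  (Real.smoothTransition.contDiff (n := 1)).continuous_deriv le_rfl

theorem Real.deriv_smoothTransition_of_neg {t : ℝ} (h : t < 0) :
    deriv Real.smoothTransition t = 0 := by
  have : Real.smoothTransition =ᶠ[𝓝 t] fun _ => 0 := by
    filter_upwards [Iio_mem_nhds h] with s hs using Real.smoothTransition.zero_of_nonpos hs.le
  simp [this.deriv_eq]

theorem Real.deriv_smoothTransition_of_one_lt {t : ℝ} (h : 1 < t) :
    deriv Real.smoothTransition t = 0 := by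
  have : Real.smoothTransition =ᶠ[𝓝 t] fun _ => 1 := by
    filter_upwards [Ioi_mem_nhds h] with s hs using Real.smoothTransition.one_of_one_le hs.le
  simp [this.deriv_eq]

/-- Concatenated curves may have a corner, so both are reparametrised by `Real.smoothTransition` to
come to rest at the junction. -/
theorem mem_leafIn_trans {θ : ℂ × ℂ → ℂ × ℂ} {A : Set (ℂ × ℂ)} {p q r : ℂ × ℂ}
    (h : q ∈ leafIn θ A p) (h' : r ∈ leafIn θ A q) : r ∈ leafIn θ A p := by
  obtain ⟨γ, c, hc, hA, hγ, h0, h1⟩ := h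
  obtain ⟨δ, d, hd, hB, hδ, k0, k1⟩ := h'
  set σ := Real.smoothTransition with hσ
  have hσ1 : ∀ t : ℝ, 1 ≤ t → σ t = 1 := fun t => Real.smoothTransition.one_of_one_le
  have hσ0 : ∀ t : ℝ, t ≤ 0 → σ t = 0 := fun t => Real.smoothTransition.zero_of_nonpos
  have hσc : Continuous (deriv σ) := Real.continuous_deriv_smoothTransition
  have hσc' : Continuous σ := Real.smoothTransition.continuous
  have e1 : ∀ t : ℝ, HasDerivAt (fun t => γ (σ (3 * t)))
      (((3 * deriv σ (3 * t) : ℝ) * c (σ (3 * t))) • θ (γ (σ (3 * t)))) t := by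
    intro t
    have a1 : HasDerivAt (fun t : ℝ => 3 * t) 3 t := by simpa using (hasDerivAt_id t).const_mul 3
    have := (hγ (σ (3 * t))).scomp t
      ((Real.smoothTransition_hasDerivAt (3 * t)).scomp t a1)
    refine this.congr_deriv ?_
    simp [hσ, mul_smul, ← Complex.coe_smul]
  have e2 : ∀ t : ℝ, HasDerivAt (fun t => δ (σ (3 * t - 2)))
      (((3 * deriv σ (3 * t - 2) : ℝ) * d (σ (3 * t - 2))) • θ (δ (σ (3 * t - 2)))) t := by
    intro t
    have a1 : HasDerivAt (fun t : ℝ => 3 * t - 2) 3 t := by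
      simpa using ((hasDerivAt_id t).const_mul 3).sub_const 2
    have := (hδ (σ (3 * t - 2))).scomp t
      ((Real.smoothTransition_hasDerivAt (3 * t - 2)).scomp t a1)
    refine this.congr_deriv ?_
    simp [hσ, mul_smul, ← Complex.coe_smul]
  -- The pieces overlap: for `1/3 ≤ t ≤ 2/3` both formulas give the common point `q`, so `ρ` is
  -- locally one of two smooth curves.
  set ρ : ℝ → ℂ × ℂ := fun t => if t ≤ 1 / 2 then γ (σ (3 * t)) else δ (σ (3 * t - 2)) with hρ
  have r1 : ∀ t < 2 / 3, ρ t = γ (σ (3 * t)) := by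
    intro t ht
    by_cases h : t ≤ 1 / 2
    · simp only [hρ, if_pos h]
    · simp only [hρ, if_neg h]
      rw [hσ1 (3 * t) (by linarith), hσ0 _ (by linarith), k0, h1]
  have r2 : ∀ t > 1 / 3, ρ t = δ (σ (3 * t - 2)) := by
    intro t ht
    by_cases h : t ≤ 1 / 2
    · simp only [hρ, if_pos h]
      rw [hσ1 (3 * t) (by linarith), hσ0 _ (by linarith), k0, h1]
    · simp only [hρ, if_neg h]
  -- The sum of the two velocity factors is continuous without a case split, and each summand
  -- vanishes while the other piece is moving.
  refine ⟨ρ, fun t => (3 * deriv σ (3 * t) : ℝ) * c (σ (3 * t)) +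
      (3 * deriv σ (3 * t - 2) : ℝ) * d (σ (3 * t - 2)), ?_, ?_, ?_, ?_, ?_⟩
  · exact ((Complex.continuous_ofReal.comp (by fun_prop)).mul (by fun_prop)).add
      ((Complex.continuous_ofReal.comp (by fun_prop)).mul (by fun_prop))
  · intro t
    by_cases h : t ≤ 1 / 2
    · simpa only [hρ, if_pos h] using hA _
    · simpa only [hρ, if_neg h] using hB _
  · intro t
    rcases lt_or_ge t (2 / 3) with h | h
    · have := (e1 t).congr_of_eventuallyEq (f₁ := ρ)
        (by filter_upwards [Iio_mem_nhds h] with s hs using r1 s hs)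
      rw [← r1 t h] at this
      have z : deriv σ (3 * t - 2) = 0 := Real.deriv_smoothTransition_of_neg (by linarith)
      simpa [z] using this
    · have h' : t > 1 / 3 := by linarith
      have := (e2 t).congr_of_eventuallyEq (f₁ := ρ)
        (by filter_upwards [Ioi_mem_nhds h'] with s hs using r2 s hs)
      rw [← r2 t h'] at this
      have z : deriv σ (3 * t) = 0 := Real.deriv_smoothTransition_of_one_lt (by linarith)
      simpa [z] using this
  · rw [r1 0 (by norm_num), mul_zero, hσ0 0 le_rfl, h0]
  · rw [r2 1 (by norm_num), hσ1 _ (by norm_num), k1]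

theorem leafIn_eq_of_mem {θ : ℂ × ℂ → ℂ × ℂ} {A : Set (ℂ × ℂ)} {p q : ℂ × ℂ}
    (h : q ∈ leafIn θ A p) : leafIn θ A q = leafIn θ A p :=
  Subset.antisymm (fun _ hr => mem_leafIn_trans h hr)
    fun _ hr => mem_leafIn_trans (mem_leafIn_symm h) hr

theorem leafIn_subset_of_smul {θ η : ℂ × ℂ → ℂ × ℂ} {A : Set (ℂ × ℂ)} {h : ℂ × ℂ → ℂ}
    (hh : ContinuousOn h A) (hθ : ∀ p ∈ A, θ p = h p • η p) (p : ℂ × ℂ) :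
    leafIn θ A p ⊆ leafIn η A p := by
  rintro q ⟨γ, c, hc, hA, hγ, h0, h1⟩
  have hγc : Continuous γ := continuous_iff_continuousAt.2 fun t => (hγ t).continuousAt
  refine ⟨γ, fun t => c t * h (γ t), hc.mul (hh.comp_continuous hγc hA), hA, fun t => ?_, h0, h1⟩
  simpa [hθ _ (hA t), mul_smul] using hγ t

theorem PlaneGerm.RepresentedBy.leafIn_eq {F : PlaneGerm} {η : ℂ × ℂ → ℂ × ℂ}
    (hF : F.RepresentedBy η) {A : Set (ℂ × ℂ)} (hA : A ⊆ F.U) (p : ℂ × ℂ) :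
    leafIn F.θ A p = leafIn η A p := by
  obtain ⟨h, hd, h0, hθ⟩ := hF
  have hc : ContinuousOn h A := hd.continuousOn.mono hA
  refine Subset.antisymm (leafIn_subset_of_smul hc (fun p hp => hθ p (hA hp)) p)
    (leafIn_subset_of_smul (hc.inv₀ fun p hp => h0 p (hA hp)) (fun p hp => ?_) p)
  simp [hθ p (hA hp), smul_smul, h0 p (hA hp)]

/-! ### Leaves and complex flows -/

/-- The curve `Φ ∘ ζ` has velocity `ζ' • θ`, so leaf membership becomes a question of joining times
inside the preimage of `A`. -/
theorem mem_leafIn_of_flow {θ : ℂ × ℂ → ℂ × ℂ} {A : Set (ℂ × ℂ)} {Φ : ℂ → ℂ × ℂ}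
    (hΦ : ∀ z, HasDerivAt Φ (θ (Φ z)) z) {ζ : ℝ → ℂ} (hζ : ContDiff ℝ 1 ζ)
    (hA : ∀ t, Φ (ζ t) ∈ A) (t₀ t₁ : ℝ) : Φ (ζ t₁) ∈ leafIn θ A (Φ (ζ t₀)) := by
  have hc : Continuous (deriv ζ) := hζ.continuous_deriv le_rfl
  refine ⟨fun t => Φ (ζ (t₀ + t * (t₁ - t₀))),
    fun t => ((t₁ - t₀ : ℝ) : ℂ) * deriv ζ (t₀ + t * (t₁ - t₀)), by fun_prop, fun t => hA _,
    fun t => ?_, by simp, by simp⟩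
  have a1 : HasDerivAt (fun t : ℝ => t₀ + t * (t₁ - t₀)) (t₁ - t₀) t := by
    simpa using ((hasDerivAt_id t).mul_const (t₁ - t₀)).const_add t₀
  have a2 := ((hζ.differentiable one_ne_zero (t₀ + t * (t₁ - t₀))).hasDerivAt).scomp t a1
  refine ((hΦ (ζ (t₀ + t * (t₁ - t₀)))).scomp t a2).congr_deriv ?_
  simp

theorem mem_leafIn_of_convex {θ : ℂ × ℂ → ℂ × ℂ} {A : Set (ℂ × ℂ)} {Φ : ℂ → ℂ × ℂ}
    (hΦ : ∀ z, HasDerivAt Φ (θ (Φ z)) z) {S : Set ℂ} (hS : Convex ℝ S) (hA : ∀ z ∈ S, Φ z ∈ A)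
    {z₀ z₁ : ℂ} (h₀ : z₀ ∈ S) (h₁ : z₁ ∈ S) : Φ z₁ ∈ leafIn θ A (Φ z₀) := by
  -- A curve in `leafIn` must stay in `A` for every real `t`; the smooth transition keeps the time
  -- on the segment from `z₀` to `z₁` even outside `[0, 1]`.
  have hc : ContDiff ℝ 1 fun t : ℝ => z₀ + (Real.smoothTransition t) • (z₁ - z₀) :=
    contDiff_const.add (Real.smoothTransition.contDiff.smul contDiff_const)
  have := mem_leafIn_of_flow (A := A) hΦ hc (fun t => hA _ ?_) 0 1
  · simpa using this
  · exact hS.add_smul_sub_mem h₀ h₁ ⟨Real.smoothTransition.nonneg _, Real.smoothTransition.le_one _⟩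

/-- The flow of `linearField l`. -/
noncomputable def linearFlow (l : ℂ) (p : ℂ × ℂ) (z : ℂ) : ℂ × ℂ :=
  (p.1 * Complex.exp (l * z), p.2 * Complex.exp z)

/-- The flow of `resonantField m`. -/
noncomputable def resonantFlow (m : ℕ) (p : ℂ × ℂ) (z : ℂ) : ℂ × ℂ :=
  (Complex.exp (m * z) * (p.1 + p.2 ^ m * z), p.2 * Complex.exp z)

@[simp] theorem linearFlow_zero (l : ℂ) (p : ℂ × ℂ) : linearFlow l p 0 = p := by
  simp [linearFlow]

@[simp] theorem resonantFlow_zero (m : ℕ) (p : ℂ × ℂ) : resonantFlow m p 0 = p := by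
  simp [resonantFlow]

theorem hasDerivAt_cexp_mul (l z : ℂ) :
    HasDerivAt (fun z => Complex.exp (l * z)) (l * Complex.exp (l * z)) z := by
  have := ((hasDerivAt_id z).const_mul l).cexp
  simpa [mul_comm] using this

theorem hasDerivAt_linearFlow (l : ℂ) (p : ℂ × ℂ) (z : ℂ) :
    HasDerivAt (linearFlow l p) (linearField l (linearFlow l p z)) z := by
  have h1 := (hasDerivAt_cexp_mul l z).const_mul p.1
  have h2 := (Complex.hasDerivAt_exp z).const_mul p.2
  refine (h1.prodMk h2).congr_deriv ?_
  simp only [linearField, linearFlow, Prod.mk.injEq, and_true]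
  ring

theorem hasDerivAt_resonantFlow (m : ℕ) (p : ℂ × ℂ) (z : ℂ) :
    HasDerivAt (resonantFlow m p) (resonantField m (resonantFlow m p z)) z := by
  have h1 := (hasDerivAt_cexp_mul m z).mul (((hasDerivAt_id z).const_mul (p.2 ^ m)).const_add p.1)
  have h2 := (Complex.hasDerivAt_exp z).const_mul p.2
  refine (h1.prodMk h2).congr_deriv ?_
  simp only [resonantField, resonantFlow, Prod.mk.injEq, and_true, mul_pow, ← Complex.exp_nat_mul,
    id]
  ring

theorem continuous_linearFlow (l : ℂ) (p : ℂ × ℂ) : Continuous (linearFlow l p) :=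
  continuous_iff_continuousAt.2 fun z => (hasDerivAt_linearFlow l p z).continuousAt

theorem continuous_resonantFlow (m : ℕ) (p : ℂ × ℂ) : Continuous (resonantFlow m p) :=
  continuous_iff_continuousAt.2 fun z => (hasDerivAt_resonantFlow m p z).continuousAt

/-! ### Leaves are contained in flow orbits. -/

theorem hasDerivAt_fst {γ : ℝ → ℂ × ℂ} {v : ℂ × ℂ} {t : ℝ} (h : HasDerivAt γ v t) :
    HasDerivAt (fun t => (γ t).1) v.1 t := by
  simpa using (HasFDerivAt.fst h.hasFDerivAt).hasDerivAt

theorem hasDerivAt_snd {γ : ℝ → ℂ × ℂ} {v : ℂ × ℂ} {t : ℝ} (h : HasDerivAt γ v t) :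
    HasDerivAt (fun t => (γ t).2) v.2 t := by
  simpa using (HasFDerivAt.snd h.hasFDerivAt).hasDerivAt

theorem eq_of_hasDerivAt_zero {f : ℝ → ℂ} (h : ∀ t, HasDerivAt f 0 t) (s t : ℝ) : f s = f t :=
  is_const_of_deriv_eq_zero (fun t => (h t).differentiableAt) (fun t => (h t).deriv) s t

theorem exists_primitive {c : ℝ → ℂ} (hc : Continuous c) :
    ∃ C : ℝ → ℂ, C 0 = 0 ∧ ∀ t, HasDerivAt C (c t) t :=
  ⟨fun t => ∫ s in (0 : ℝ)..t, c s, by simp, fun t =>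
    intervalIntegral.integral_hasDerivAt_right (hc.intervalIntegrable _ _)
      (hc.stronglyMeasurableAtFilter _ _) hc.continuousAt⟩

theorem eq_mul_exp_of_hasDerivAt {f c C : ℝ → ℂ} {l : ℂ} (hC0 : C 0 = 0)
    (hC : ∀ t, HasDerivAt C (c t) t) (hf : ∀ t, HasDerivAt f (c t * (l * f t)) t) (t : ℝ) :
    f t = f 0 * Complex.exp (l * C t) := by
  have key : ∀ t, HasDerivAt (fun t => f t * Complex.exp (-(l * C t))) 0 t := by
    intro t
    have := (hf t).mul (((hC t).const_mul l).neg.cexp)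
    refine this.congr_deriv ?_
    ring
  have := eq_of_hasDerivAt_zero key t 0
  simp only [hC0, mul_zero, neg_zero, Complex.exp_zero, mul_one] at this
  rw [← this, mul_assoc, ← Complex.exp_add]
  simp

/-- The flow time is the integral of `c` over `[0, 1]`; both coordinates solve a scalar linear
equation. -/
theorem exists_linearFlow_of_mem_leafIn {l : ℂ} {A : Set (ℂ × ℂ)} {p q : ℂ × ℂ}
    (h : q ∈ leafIn (linearField l) A p) : ∃ z, q = linearFlow l p z := by
  obtain ⟨γ, c, hc, -, hγ, h0, h1⟩ := h
  obtain ⟨C, hC0, hC⟩ := exists_primitive hc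
  have k1 := eq_mul_exp_of_hasDerivAt (l := l) hC0 hC
    (fun t => by simpa [linearField] using hasDerivAt_fst (hγ t)) 1
  have k2 := eq_mul_exp_of_hasDerivAt (l := 1) hC0 hC
    (fun t => by simpa [linearField] using hasDerivAt_snd (hγ t)) 1
  refine ⟨C 1, ?_⟩
  rw [← h1, ← h0]
  ext1
  · simpa [linearFlow] using k1
  · simpa [linearFlow] using k2

theorem exists_resonantFlow_of_mem_leafIn {m : ℕ} {A : Set (ℂ × ℂ)} {p q : ℂ × ℂ}
    (h : q ∈ leafIn (resonantField m) A p) : ∃ z, q = resonantFlow m p z := by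
  obtain ⟨γ, c, hc, -, hγ, h0, h1⟩ := h
  obtain ⟨C, hC0, hC⟩ := exists_primitive hc
  have k2 := eq_mul_exp_of_hasDerivAt (l := 1) hC0 hC
    (fun t => by simpa [resonantField] using hasDerivAt_snd (hγ t))
  simp only [one_mul, h0] at k2
  -- Variation of constants: removing the factor `exp (m C)` from the first coordinate leaves `p.1 +
  -- p.2 ^ m * C`.
  have k1 : ∀ t, HasDerivAt
      (fun t => (γ t).1 * Complex.exp (-((m : ℂ) * C t)) - p.2 ^ m * C t) 0 t := by
    intro t
    have a1 := hasDerivAt_fst (hγ t)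
    simp only [resonantField, Prod.smul_fst, smul_eq_mul, k2 t, mul_pow, ← Complex.exp_nat_mul]
      at a1
    have := (a1.mul (((hC t).const_mul (m : ℂ)).neg.cexp)).sub ((hC t).const_mul (p.2 ^ m))
    refine this.congr_deriv ?_
    have e : Complex.exp (m * C t) * Complex.exp ((-fun y => (m : ℂ) * C y) t) = 1 := by
      rw [← Complex.exp_add]; simp
    linear_combination (c t * p.2 ^ m) * e
  have k3 := eq_of_hasDerivAt_zero k1 1 0
  simp only [hC0, mul_zero, neg_zero, Complex.exp_zero, mul_one, sub_zero, h0] at k3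
  refine ⟨C 1, ?_⟩
  rw [← h1]
  ext1
  · have e : Complex.exp (m * C 1) * Complex.exp (-(m * C 1)) = 1 := by
      rw [← Complex.exp_add]; simp
    simp only [resonantFlow]
    linear_combination (-(γ 1).1) * e + Complex.exp (m * C 1) * k3
  · simpa [resonantFlow] using k2 1

/-! ### Leaves that are closed away from the origin, and topological invariants of germs -/

/-- The leaf through `p` in `V` is closed in `V \ {0}`. -/
def LeafClosed (θ : ℂ × ℂ → ℂ × ℂ) (V : Set (ℂ × ℂ)) (p : ℂ × ℂ) : Prop :=
  ∀ q ∈ V, q ≠ 0 → q ∈ closure (leafIn θ V p) → q ∈ leafIn θ V p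

/-- The local homeomorphism `φ` fixes `0` and maps the leaves of `θ` onto the leaves of `η`. -/
structure ConjugatesLeaves (φ : OpenPartialHomeomorph (ℂ × ℂ) (ℂ × ℂ))
    (θ η : ℂ × ℂ → ℂ × ℂ) : Prop where
  zero_mem : (0 : ℂ × ℂ) ∈ φ.source
  map_zero : φ 0 = 0
  image_leaf : ∀ p ∈ φ.source, φ '' leafIn θ φ.source p = leafIn η φ.target (φ p)

/-- All leaves near `0` are closed away from `0`. -/
def AllLeavesClosed (θ : ℂ × ℂ → ℂ × ℂ) (V : Set (ℂ × ℂ)) : Prop :=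
  ∀ᶠ p in 𝓝 (0 : ℂ × ℂ), p ≠ 0 → LeafClosed θ V p

/-- There is at most one leaf near `0` that is closed away from `0`. -/
def AtMostOneClosedLeaf (θ : ℂ × ℂ → ℂ × ℂ) (V : Set (ℂ × ℂ)) : Prop :=
  ∃ W ∈ 𝓝 (0 : ℂ × ℂ), ∀ p ∈ W, ∀ q ∈ W, p ≠ 0 → q ≠ 0 → LeafClosed θ V p → LeafClosed θ V q →
    leafIn θ V p = leafIn θ V q

/-- The closure of every non-closed leaf near `0` meets closed leaves arbitrarily close to `0`. -/
def ClosuresMeetClosedLeaves (θ : ℂ × ℂ → ℂ × ℂ) (V : Set (ℂ × ℂ)) : Prop :=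
  ∀ᶠ p in 𝓝 (0 : ℂ × ℂ), p ≠ 0 → ¬ LeafClosed θ V p →
    ∃ᶠ q in 𝓝[≠] (0 : ℂ × ℂ), q ∈ closure (leafIn θ V p) ∧ LeafClosed θ V q

namespace ConjugatesLeaves

variable {φ : OpenPartialHomeomorph (ℂ × ℂ) (ℂ × ℂ)} {θ η : ℂ × ℂ → ℂ × ℂ}

theorem symm_zero (h : ConjugatesLeaves φ θ η) : φ.symm 0 = 0 := by
  conv_lhs => rw [← h.map_zero]
  exact φ.left_inv h.zero_mem

theorem symm (h : ConjugatesLeaves φ θ η) : ConjugatesLeaves φ.symm η θ where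
  zero_mem := by simpa [h.map_zero] using φ.map_source h.zero_mem
  map_zero := h.symm_zero
  image_leaf p hp := by
    have h1 := h.image_leaf (φ.symm p) (φ.map_target hp)
    rw [φ.right_inv hp] at h1
    simp only [OpenPartialHomeomorph.symm_source, OpenPartialHomeomorph.symm_target]
    rw [← h1, image_image]
    refine (image_congr fun x hx => φ.left_inv (leafIn_subset hx)).trans (by simp)

theorem mem_closure (h : ConjugatesLeaves φ θ η) {p q : ℂ × ℂ} (hp : p ∈ φ.source)
    (hq : q ∈ φ.source) (hpq : q ∈ closure (leafIn θ φ.source p)) :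
    φ q ∈ closure (leafIn η φ.target (φ p)) := by
  rw [← h.image_leaf p hp]
  exact mem_closure_image (φ.continuousAt hq) hpq

theorem leafClosed (h : ConjugatesLeaves φ θ η) {p : ℂ × ℂ} (hp : p ∈ φ.source)
    (hc : LeafClosed θ φ.source p) : LeafClosed η φ.target (φ p) := by
  intro q hq h0 hcl
  have h1 := h.symm.mem_closure (p := φ p) (φ.map_source hp) hq hcl
  simp only [OpenPartialHomeomorph.symm_target, φ.left_inv hp] at h1
  rw [← h.image_leaf p hp]
  refine ⟨φ.symm q, hc _ (φ.map_target hq) (fun e => h0 ?_) h1, φ.right_inv hq⟩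
  rw [← φ.right_inv hq, e, h.map_zero]

theorem leafClosed_iff (h : ConjugatesLeaves φ θ η) {p : ℂ × ℂ} (hp : p ∈ φ.source) :
    LeafClosed η φ.target (φ p) ↔ LeafClosed θ φ.source p := by
  refine ⟨fun hc => ?_, h.leafClosed hp⟩
  simpa [φ.left_inv hp] using h.symm.leafClosed (p := φ p) (φ.map_source hp) hc

theorem tendsto (h : ConjugatesLeaves φ θ η) : Tendsto φ (𝓝 0) (𝓝 0) := by
  simpa [h.map_zero] using (φ.continuousAt h.zero_mem).tendsto

theorem ne_zero (h : ConjugatesLeaves φ θ η) {p : ℂ × ℂ} (hp : p ∈ φ.source) (h0 : p ≠ 0) :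
    φ p ≠ 0 := fun e => h0 (φ.injOn hp h.zero_mem (e.trans h.map_zero.symm))

theorem eventually_mem (h : ConjugatesLeaves φ θ η) : ∀ᶠ p in 𝓝 (0 : ℂ × ℂ), p ∈ φ.source :=
  φ.open_source.mem_nhds h.zero_mem

theorem allLeavesClosed (h : ConjugatesLeaves φ θ η) (ha : AllLeavesClosed η φ.target) :
    AllLeavesClosed θ φ.source := by
  filter_upwards [h.tendsto.eventually ha, h.eventually_mem] with p hp hs h0
  exact (h.leafClosed_iff hs).1 (hp (h.ne_zero hs h0))

theorem atMostOneClosedLeaf (h : ConjugatesLeaves φ θ η) (ha : AtMostOneClosedLeaf η φ.target) :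
    AtMostOneClosedLeaf θ φ.source := by
  obtain ⟨W, hW, hH⟩ := ha
  refine ⟨φ ⁻¹' W ∩ φ.source, inter_mem (h.tendsto hW) h.eventually_mem, ?_⟩
  rintro p ⟨hp, hps⟩ q ⟨hq, hqs⟩ hp0 hq0 hpc hqc
  have := hH _ hp _ hq (h.ne_zero hps hp0) (h.ne_zero hqs hq0) (h.leafClosed hps hpc)
    (h.leafClosed hqs hqc)
  rw [← h.image_leaf p hps, ← h.image_leaf q hqs] at this
  exact φ.injOn.image_eq_image_iff leafIn_subset leafIn_subset |>.1 this

theorem closuresMeetClosedLeaves (h : ConjugatesLeaves φ θ η)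
    (ha : ClosuresMeetClosedLeaves η φ.target) : ClosuresMeetClosedLeaves θ φ.source := by
  filter_upwards [h.tendsto.eventually ha, h.eventually_mem] with p hp hs h0 hc
  have h1 := hp (h.ne_zero hs h0) (fun hc' => hc ((h.leafClosed_iff hs).1 hc'))
  have hT : Tendsto φ.symm (𝓝[≠] 0) (𝓝[≠] 0) := by
    refine tendsto_nhdsWithin_iff.2 ⟨h.symm.tendsto.mono_left nhdsWithin_le_nhds, ?_⟩
    filter_upwards [self_mem_nhdsWithin, nhdsWithin_le_nhds h.symm.eventually_mem] with q hq hqs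
    exact h.symm.ne_zero hqs hq
  refine hT.frequently ((h1.and_eventually (nhdsWithin_le_nhds h.symm.eventually_mem)).mono ?_)
  rintro q ⟨⟨hq1, hq2⟩, hqt⟩
  refine ⟨?_, h.symm.leafClosed hqt hq2⟩
  simpa [φ.left_inv hs] using h.symm.mem_closure (p := φ p) (φ.map_source hs) hqt hq1

end ConjugatesLeaves

/-! ### Local structure of leaves -/

theorem eventually_flow_mem_leafIn {θ : ℂ × ℂ → ℂ × ℂ} {V : Set (ℂ × ℂ)} (hV : IsOpen V)
    {Φ : ℂ → ℂ × ℂ} (hΦ : ∀ z, HasDerivAt Φ (θ (Φ z)) z) (h0 : Φ 0 ∈ V) :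
    ∀ᶠ w in 𝓝 0, Φ w ∈ leafIn θ V (Φ 0) := by
  obtain ⟨ε, hε, hb⟩ := Metric.mem_nhds_iff.1 ((hΦ 0).continuousAt (hV.mem_nhds h0))
  filter_upwards [Metric.ball_mem_nhds 0 hε] with w hw
  exact mem_leafIn_of_convex hΦ (convex_ball 0 ε) hb (Metric.mem_ball_self hε) hw

/-- If leaf points close to a limit point `q` already lie on the leaf of `q`, the two leaves share a
point and coincide. -/
theorem leafClosed_of_eventually {θ : ℂ × ℂ → ℂ × ℂ} {V : Set (ℂ × ℂ)} {p : ℂ × ℂ}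
    (h : ∀ q ∈ V, q ≠ 0 → q ∈ closure (leafIn θ V p) →
      ∀ᶠ x in 𝓝 q, x ∈ leafIn θ V p → x ∈ leafIn θ V q) : LeafClosed θ V p := by
  intro q hq h0 hc
  obtain ⟨x, hx, hx'⟩ := ((mem_closure_iff_frequently.1 hc).and_eventually (h q hq h0 hc)).exists
  exact mem_leafIn_trans hx (mem_leafIn_symm (hx' hx))

theorem eventually_linearFlow_mem_leafIn {V : Set (ℂ × ℂ)} (hV : IsOpen V) {l : ℂ} {q : ℂ × ℂ}
    (hq : q ∈ V) {w : ℂ × ℂ → ℂ} (hw : ContinuousAt w q) (hw0 : w q = 0) :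
    ∀ᶠ x in 𝓝 q, linearFlow l q (w x) ∈ leafIn (linearField l) V q := by
  have := eventually_flow_mem_leafIn hV (hasDerivAt_linearFlow l q) (by simpa using hq)
  rw [linearFlow_zero] at this
  rw [ContinuousAt, hw0] at hw
  exact hw.eventually this

theorem continuousAt_log_div {c : ℂ} (hc : c ≠ 0) : ContinuousAt (fun x => Complex.log (x / c)) c := by
  refine (continuousAt_id.div_const c).clog ?_
  simp [hc]

theorem fst_eq_zero_iff_of_mem_closure {l : ℂ} {V : Set (ℂ × ℂ)} {p q : ℂ × ℂ} (hp : p.1 = 0)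
    (h : q ∈ closure (leafIn (linearField l) V p)) : q.1 = 0 := by
  refine closure_minimal (t := {x : ℂ × ℂ | x.1 = 0}) ?_
    (isClosed_singleton.preimage continuous_fst) h
  intro x hx
  obtain ⟨z, rfl⟩ := exists_linearFlow_of_mem_leafIn hx
  simp [linearFlow, hp]

theorem snd_eq_zero_of_mem_closure {l : ℂ} {V : Set (ℂ × ℂ)} {p q : ℂ × ℂ} (hp : p.2 = 0)
    (h : q ∈ closure (leafIn (linearField l) V p)) : q.2 = 0 := by
  refine closure_minimal (t := {x : ℂ × ℂ | x.2 = 0}) ?_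
    (isClosed_singleton.preimage continuous_snd) h
  intro x hx
  obtain ⟨z, rfl⟩ := exists_linearFlow_of_mem_leafIn hx
  simp [linearFlow, hp]

theorem leafClosed_of_snd_eq_zero {l : ℂ} (hl : l ≠ 0) {V : Set (ℂ × ℂ)} (hV : IsOpen V)
    {p : ℂ × ℂ} (hp : p.2 = 0) : LeafClosed (linearField l) V p := by
  refine leafClosed_of_eventually fun q hq h0 hc => ?_
  have hq2 := snd_eq_zero_of_mem_closure hp hc
  have hq1 : q.1 ≠ 0 := fun h => h0 (Prod.ext h hq2)
  -- This is the small time that carries `q` to a nearby point `x` of the axis.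
  have hw : ContinuousAt (fun x : ℂ × ℂ => Complex.log (x.1 / q.1) / l) q :=
    ((continuousAt_log_div hq1).comp (f := Prod.fst) continuousAt_fst).div_const l
  filter_upwards [eventually_linearFlow_mem_leafIn hV (l := l) hq hw (by simp [hq1]),
    (continuousAt_fst (p := q)).eventually_ne hq1] with x hx hx1 hxp
  convert hx using 1
  have := snd_eq_zero_of_mem_closure hp (subset_closure hxp)
  ext1
  · simp only [linearFlow]
    rw [mul_div_cancel₀ _ hl, Complex.exp_log (div_ne_zero hx1 hq1), mul_div_cancel₀ _ hq1]
  · simp [linearFlow, hq2, this]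

theorem leafClosed_of_fst_eq_zero {l : ℂ} {V : Set (ℂ × ℂ)} (hV : IsOpen V)
    {p : ℂ × ℂ} (hp : p.1 = 0) : LeafClosed (linearField l) V p := by
  refine leafClosed_of_eventually fun q hq h0 hc => ?_
  have hq1 := fst_eq_zero_iff_of_mem_closure hp hc
  have hq2 : q.2 ≠ 0 := fun h => h0 (Prod.ext hq1 h)
  have hw : ContinuousAt (fun x : ℂ × ℂ => Complex.log (x.2 / q.2)) q :=
    (continuousAt_log_div hq2).comp (f := Prod.snd) continuousAt_snd
  filter_upwards [eventually_linearFlow_mem_leafIn hV (l := l) hq hw (by simp [hq2]),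
    (continuousAt_snd (p := q)).eventually_ne hq2] with x hx hx2 hxp
  convert hx using 1
  have := fst_eq_zero_iff_of_mem_closure hp (subset_closure hxp)
  ext1
  · simp [linearFlow, hq1, this]
  · simp only [linearFlow]
    rw [Complex.exp_log (div_ne_zero hx2 hq2), mul_div_cancel₀ _ hq2]

theorem eventually_eq_one_of_pow_eq_one {n : ℕ} (hn : 0 < n) :
    ∀ᶠ z in 𝓝 (1 : ℂ), z ^ n = 1 → z = 1 := by
  have := ((Polynomial.nthRootsFinset n (1 : ℂ)).erase 1).finite_toSet.isClosed.isOpen_compl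
  filter_upwards [this.mem_nhds (by simp)] with z hz h
  by_contra h1
  exact hz (by simp [h1, Polynomial.mem_nthRootsFinset hn, h])

theorem linearFlow_first_integral {l : ℂ} {n k : ℕ} (hl : l * n = k) (p : ℂ × ℂ) (z : ℂ) :
    (linearFlow l p z).1 ^ n * p.2 ^ k = p.1 ^ n * (linearFlow l p z).2 ^ k := by
  have : Complex.exp (l * z) ^ n = Complex.exp z ^ k := by
    rw [← Complex.exp_nat_mul, ← Complex.exp_nat_mul, ← hl]; ring_nf
  simp only [linearFlow, mul_pow, this]
  ring

/-- Here `l = k / n`, and `x ^ n / y ^ k` is constant on leaves. Close to `q`, flowing until the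
second coordinates agree leaves a discrepancy in the first that is an `n`-th root of unity near `1`,
hence equal to `1`. -/
theorem leafClosed_of_rational {l : ℂ} {n k : ℕ} (hl : l * n = k) (hn : 0 < n) (hk : 0 < k)
    {V : Set (ℂ × ℂ)} (hV : IsOpen V) (p : ℂ × ℂ) : LeafClosed (linearField l) V p := by
  have hl0 : l ≠ 0 := by
    rintro rfl
    simp [eq_comm, hk.ne'] at hl
  by_cases ha : p.1 = 0
  · exact leafClosed_of_fst_eq_zero hV ha
  by_cases hb : p.2 = 0
  · exact leafClosed_of_snd_eq_zero hl0 hV hb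
  have hI : ∀ q ∈ closure (leafIn (linearField l) V p), q.1 ^ n * p.2 ^ k = p.1 ^ n * q.2 ^ k := by
    refine closure_minimal (t := {q : ℂ × ℂ | q.1 ^ n * p.2 ^ k = p.1 ^ n * q.2 ^ k}) ?_
      (isClosed_eq (by fun_prop) (by fun_prop))
    intro q hq
    obtain ⟨z, rfl⟩ := exists_linearFlow_of_mem_leafIn hq
    exact linearFlow_first_integral hl p z
  refine leafClosed_of_eventually fun q hq h0 hc => ?_
  have hqI := hI q hc
  have hq1 : q.1 ≠ 0 := by
    intro h
    refine h0 (Prod.ext h ?_)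
    simpa [h, hn.ne', ha, hk.ne', eq_comm] using hqI
  have hq2 : q.2 ≠ 0 := by
    intro h
    simp [h, hn.ne', hb, hk.ne', hq1] at hqI
  have hw : ContinuousAt (fun x : ℂ × ℂ => Complex.log (x.2 / q.2)) q :=
    (continuousAt_log_div hq2).comp (f := Prod.snd) continuousAt_snd
  -- The ratio of the first coordinates of `x` and of the flow of `q` at the time matching second
  -- coordinates.
  have hζ : ContinuousAt
      (fun x : ℂ × ℂ => x.1 / (q.1 * Complex.exp (l * Complex.log (x.2 / q.2)))) q := by
    refine continuousAt_fst.div (continuousAt_const.mul (continuousAt_const.mul hw).cexp) ?_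
    simp [hq1]
  have hζ1 : q.1 / (q.1 * Complex.exp (l * Complex.log (q.2 / q.2))) = 1 := by simp [hq1, hq2]
  rw [ContinuousAt, hζ1] at hζ
  filter_upwards [eventually_linearFlow_mem_leafIn hV (l := l) hq hw (by simp [hq2]),
    (continuousAt_snd (p := q)).eventually_ne hq2,
    hζ.eventually (eventually_eq_one_of_pow_eq_one hn)] with x hx hx2 hx1 hxp
  have hxI := hI x (subset_closure hxp)
  have hex : Complex.exp (Complex.log (x.2 / q.2)) = x.2 / q.2 :=
    Complex.exp_log (div_ne_zero hx2 hq2)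
  have hE : Complex.exp (l * Complex.log (x.2 / q.2)) ^ n = (x.2 / q.2) ^ k := by
    rw [← hex, ← Complex.exp_nat_mul, ← Complex.exp_nat_mul, hex, ← hl]; ring_nf
  have hpow : x.1 ^ n * q.2 ^ k = q.1 ^ n * x.2 ^ k := by
    have e : p.1 ^ n * p.2 ^ k ≠ 0 := mul_ne_zero (pow_ne_zero _ ha) (pow_ne_zero _ hb)
    refine mul_left_cancel₀ e ?_
    linear_combination p.1 ^ n * q.2 ^ k * hxI - p.1 ^ n * x.2 ^ k * hqI
  have h1 := hx1 (by
    have hq2k : q.2 ^ k ≠ 0 := pow_ne_zero _ hq2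
    rw [div_pow, mul_pow, hE, div_pow, mul_div_assoc', ← hpow, mul_div_cancel_right₀ _ hq2k,
      div_self]
    exact fun h => mul_ne_zero (pow_ne_zero n hq1) (pow_ne_zero k hx2) (by rw [← hpow, h, zero_mul]))
  rw [div_eq_one_iff_eq (mul_ne_zero hq1 (Complex.exp_ne_zero _))] at h1
  convert hx using 1
  ext1
  · simpa [linearFlow] using h1
  · simp only [linearFlow]
    rw [hex, mul_div_cancel₀ _ hq2]

/-- The second coordinate stays `0` along the curve, and then the term `y ^ m` vanishes because `m ≠
0`. -/
theorem leafIn_resonantField_eq {m : ℕ} (hm : 1 ≤ m) {A : Set (ℂ × ℂ)} {p : ℂ × ℂ}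
    (hp : p.2 = 0) : leafIn (resonantField m) A p = leafIn (linearField m) A p := by
  have hm0 : m ≠ 0 := by omega
  have key : ∀ {γ : ℝ → ℂ × ℂ} {c : ℝ → ℂ}, Continuous c → γ 0 = p →
      (∀ t, HasDerivAt (fun t => (γ t).2) (c t * (γ t).2) t) → ∀ t, (γ t).2 = 0 := by
    intro γ c hc h0 h t
    obtain ⟨C, hC0, hC⟩ := exists_primitive hc
    have := eq_mul_exp_of_hasDerivAt (f := fun t => (γ t).2) (l := 1) hC0 hC (by simpa using h) t
    simpa [h0, hp] using this
  ext q
  constructor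
  · rintro ⟨γ, c, hc, hA, hγ, h0, h1⟩
    have hz := key hc h0 fun t => hasDerivAt_snd (hγ t)
    refine ⟨γ, c, hc, hA, fun t => ?_, h0, h1⟩
    simpa [resonantField, linearField, hz, hm0] using hγ t
  · rintro ⟨γ, c, hc, hA, hγ, h0, h1⟩
    have hz := key hc h0 fun t => hasDerivAt_snd (hγ t)
    refine ⟨γ, c, hc, hA, fun t => ?_, h0, h1⟩
    simpa [resonantField, linearField, hz, hm0] using hγ t

/-! ### Leaves in small bidiscs -/

/-- The modulus is `‖a‖ * exp (Re (l z))`, a convex function of `z`. Consequently the times spent in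
a bidisc (a ball of the sup norm) form a convex set, and each orbit meets the bidisc in a single
leaf. -/
theorem convex_setOf_norm_mul_cexp_lt (a l : ℂ) (r : ℝ) :
    Convex ℝ {z : ℂ | ‖a * Complex.exp (l * z)‖ < r} := by
  have h := ((convexOn_exp.comp_linearMap
    (Complex.reLm ∘ₗ (LinearMap.mulLeft ℝ l))).smul (norm_nonneg a)).convex_lt r
  suffices e : {z : ℂ | ‖a * Complex.exp (l * z)‖ < r} = _ from e ▸ h
  ext z
  simp [Complex.norm_exp]

theorem convex_preimage_linearFlow_ball (l : ℂ) (p : ℂ × ℂ) (r : ℝ) :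
    Convex ℝ (linearFlow l p ⁻¹' Metric.ball 0 r) := by
  have h1 := convex_setOf_norm_mul_cexp_lt p.1 l r
  have h2 := convex_setOf_norm_mul_cexp_lt p.2 1 r
  convert h1.inter h2 using 1
  ext z
  simp [linearFlow, Prod.norm_def]

theorem linearFlow_mem_leafIn_of_ball {V : Set (ℂ × ℂ)} {r : ℝ} (hr : Metric.ball 0 r ⊆ V) {l : ℂ}
    {p : ℂ × ℂ} (hp : p ∈ Metric.ball 0 r) {z : ℂ} (hz : linearFlow l p z ∈ Metric.ball 0 r) :
    linearFlow l p z ∈ leafIn (linearField l) V p := by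
  have := mem_leafIn_of_convex (A := V) (hasDerivAt_linearFlow l p)
    (convex_preimage_linearFlow_ball l p r) (fun z hz => hr hz) (z₀ := 0) (z₁ := z)
    (by simpa using hp) hz
  simpa using this

theorem mem_ball_zero_prod {p : ℂ × ℂ} {r : ℝ} :
    p ∈ Metric.ball (0 : ℂ × ℂ) r ↔ ‖p.1‖ < r ∧ ‖p.2‖ < r := by
  simp [Prod.norm_def]

theorem not_allLeavesClosed {θ : ℂ × ℂ → ℂ × ℂ} {V : Set (ℂ × ℂ)}
    (h : ∀ᶠ p in 𝓝 (0 : ℂ × ℂ), p.1 ≠ 0 → p.2 ≠ 0 → ¬ LeafClosed θ V p) :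
    ¬ AllLeavesClosed θ V := by
  intro ha
  have hd : Tendsto (fun x : ℂ => (x, x)) (𝓝[≠] 0) (𝓝 (0 : ℂ × ℂ)) :=
    (Continuous.tendsto' (f := fun x : ℂ => (x, x)) (by fun_prop) 0 0 rfl).mono_left
      nhdsWithin_le_nhds
  obtain ⟨x, ⟨hx1, hx2⟩, hx0⟩ :=
    ((hd.eventually (h.and ha)).and self_mem_nhdsWithin).exists
  exact hx1 hx0 hx0 (hx2 fun e => hx0 (congrArg Prod.fst e))

theorem not_atMostOneClosedLeaf {l : ℂ} (hl : l ≠ 0) {V : Set (ℂ × ℂ)} (hV : IsOpen V)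
    (h0 : (0 : ℂ × ℂ) ∈ V) : ¬ AtMostOneClosedLeaf (linearField l) V := by
  rintro ⟨W, hW, h⟩
  have h1 : Tendsto (fun x : ℂ => (x, (0 : ℂ))) (𝓝[≠] 0) (𝓝 (0 : ℂ × ℂ)) :=
    (Continuous.tendsto' (f := fun x : ℂ => (x, (0 : ℂ))) (by fun_prop) 0 0 rfl).mono_left
      nhdsWithin_le_nhds
  have h2 : Tendsto (fun x : ℂ => ((0 : ℂ), x)) (𝓝[≠] 0) (𝓝 (0 : ℂ × ℂ)) :=
    (Continuous.tendsto' (f := fun x : ℂ => ((0 : ℂ), x)) (by fun_prop) 0 0 rfl).mono_left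
      nhdsWithin_le_nhds
  obtain ⟨x, ⟨⟨hx1, hx2⟩, hx3⟩, hx0⟩ := (((h1.eventually hW).and (h2.eventually hW)).and
    (h2.eventually (hV.mem_nhds h0))|>.and self_mem_nhdsWithin).exists
  have := h _ hx1 _ hx2 (fun e => hx0 (congrArg Prod.fst e)) (fun e => hx0 (congrArg Prod.snd e))
    (leafClosed_of_snd_eq_zero hl hV rfl) (leafClosed_of_fst_eq_zero hV rfl)
  have hm : ((0 : ℂ), x) ∈ leafIn (linearField l) V (x, 0) := by
    rw [this]; exact mem_leafIn_self hx3
  obtain ⟨z, hz⟩ := exists_linearFlow_of_mem_leafIn hm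
  exact hx0 (by simpa [linearFlow] using congrArg Prod.snd hz)

theorem ne_zero_of_mem_leafIn_linearField {l : ℂ} {V : Set (ℂ × ℂ)} {p q : ℂ × ℂ} (hp1 : p.1 ≠ 0)
    (hp2 : p.2 ≠ 0) (h : q ∈ leafIn (linearField l) V p) : q.1 ≠ 0 ∧ q.2 ≠ 0 := by
  obtain ⟨z, rfl⟩ := exists_linearFlow_of_mem_leafIn h
  simp [linearFlow, hp1, hp2]

/-! ### The non-real case -/

theorem exists_int_mul_lt {c : ℝ} (hc : c ≠ 0) (M : ℝ) : ∃ n : ℤ, n * c < M := by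
  rcases hc.lt_or_gt with h | h
  · obtain ⟨n, hn⟩ := exists_int_gt (M / c)
    exact ⟨n, by rwa [div_lt_iff_of_neg h] at hn⟩
  · obtain ⟨n, hn⟩ := exists_int_lt (M / c)
    exact ⟨n, by rwa [lt_div_iff₀ h] at hn⟩

/-- All times `(w + 2πi n) / l` reach the first coordinate `x`. Since `Re (2πi / l) = 2π Im l /
|l|²` is nonzero, a suitable `n` makes the real part as negative as desired. -/
theorem exists_cexp_eq_and_norm_lt {l : ℂ} (hl : l.im ≠ 0) {a x : ℂ} (ha : a ≠ 0) (hx : x ≠ 0)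
    {b : ℂ} (hb : b ≠ 0) {ε : ℝ} (hε : 0 < ε) :
    ∃ z : ℂ, a * Complex.exp (l * z) = x ∧ ‖b * Complex.exp z‖ < ε := by
  have hl0 : l ≠ 0 := fun h => hl (by simp [h])
  set w := Complex.log (x / a) with hw
  have hc : (2 * Real.pi * Complex.I / l).re ≠ 0 := by
    simp [Complex.div_re, hl, hl0, Real.pi_ne_zero]
  obtain ⟨n, hn⟩ := exists_int_mul_lt hc (Real.log (ε / ‖b‖) - (w / l).re)
  refine ⟨(w + n * (2 * Real.pi * Complex.I)) / l, ?_, ?_⟩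
  · rw [mul_div_cancel₀ _ hl0, Complex.exp_add, Complex.exp_int_mul_two_pi_mul_I, mul_one, hw,
      Complex.exp_log (div_ne_zero hx ha), mul_div_cancel₀ _ ha]
  · have hb' : 0 < ‖b‖ := norm_pos_iff.2 hb
    rw [norm_mul, Complex.norm_exp, ← lt_div_iff₀' hb', ← Real.lt_log_iff_exp_lt (by positivity)]
    have : ((w + n * (2 * Real.pi * Complex.I)) / l).re =
        (w / l).re + n * (2 * Real.pi * Complex.I / l).re := by
      rw [add_div, Complex.add_re, mul_div_assoc, ← Complex.ofReal_intCast, Complex.re_ofReal_mul]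
    linarith

theorem mk_zero_mem_closure_leafIn {l : ℂ} (hl : l.im ≠ 0) {V : Set (ℂ × ℂ)} {r : ℝ}
    (hr : Metric.ball 0 r ⊆ V) {p : ℂ × ℂ} (hp : p ∈ Metric.ball 0 r) (hp1 : p.1 ≠ 0)
    (hp2 : p.2 ≠ 0) {x : ℂ} (hx0 : x ≠ 0) (hx : ‖x‖ < r) :
    (x, (0 : ℂ)) ∈ closure (leafIn (linearField l) V p) := by
  refine Metric.mem_closure_iff.2 fun ε hε => ?_
  have hr0 : 0 < r := (norm_nonneg x).trans_lt hx
  obtain ⟨z, hz1, hz2⟩ := exists_cexp_eq_and_norm_lt hl hp1 hx0 hp2 (lt_min hε hr0)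
  refine ⟨linearFlow l p z, linearFlow_mem_leafIn_of_ball hr hp ?_, ?_⟩
  · rw [mem_ball_zero_prod]
    simp only [linearFlow, hz1]
    exact ⟨hx, hz2.trans_le (min_le_right _ _)⟩
  · simp only [linearFlow, hz1]
    simpa [Prod.dist_eq, hε] using hz2.trans_le (min_le_left _ _)

theorem not_leafClosed_of_im_ne_zero {l : ℂ} (hl : l.im ≠ 0) {V : Set (ℂ × ℂ)} {r : ℝ}
    (hr0 : 0 < r) (hr : Metric.ball 0 r ⊆ V) {p : ℂ × ℂ} (hp : p ∈ Metric.ball 0 r)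
    (hp1 : p.1 ≠ 0) (hp2 : p.2 ≠ 0) : ¬ LeafClosed (linearField l) V p := by
  intro h
  have h0 : ((r / 2 : ℝ) : ℂ) ≠ 0 := by
    rw [Complex.ofReal_ne_zero]; positivity
  have h1 : ‖((r / 2 : ℝ) : ℂ)‖ < r := by
    rw [Complex.norm_real, Real.norm_of_nonneg (by positivity)]; linarith
  have hq : (((r / 2 : ℝ) : ℂ), (0 : ℂ)) ∈ leafIn (linearField l) V p := by
    refine h _ (hr ?_) (fun e => h0 (congrArg Prod.fst e))
      (mk_zero_mem_closure_leafIn hl hr hp hp1 hp2 h0 h1)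
    simpa [mem_ball_zero_prod, hr0] using h1
  exact (ne_zero_of_mem_leafIn_linearField hp1 hp2 hq).2 rfl

theorem closuresMeetClosedLeaves_of_im_ne_zero {l : ℂ} (hl : l.im ≠ 0) {V : Set (ℂ × ℂ)}
    (hV : IsOpen V) (h0 : (0 : ℂ × ℂ) ∈ V) : ClosuresMeetClosedLeaves (linearField l) V := by
  have hl0 : l ≠ 0 := fun h => hl (by simp [h])
  obtain ⟨r, hr0, hr⟩ := Metric.mem_nhds_iff.1 (hV.mem_nhds h0)
  filter_upwards [Metric.ball_mem_nhds 0 hr0] with p hp _ hc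
  have hp1 : p.1 ≠ 0 := fun h => hc (leafClosed_of_fst_eq_zero hV h)
  have hp2 : p.2 ≠ 0 := fun h => hc (leafClosed_of_snd_eq_zero hl0 hV h)
  have hT : Tendsto (fun x : ℂ => (x, (0 : ℂ))) (𝓝[≠] 0) (𝓝[≠] (0 : ℂ × ℂ)) := by
    refine tendsto_nhdsWithin_iff.2 ⟨(Continuous.tendsto' (f := fun x : ℂ => (x, (0 : ℂ)))
      (by fun_prop) 0 0 rfl).mono_left nhdsWithin_le_nhds, ?_⟩
    filter_upwards [self_mem_nhdsWithin] with x hx e using hx (congrArg Prod.fst e)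
  refine hT.frequently (Eventually.frequently ?_)
  filter_upwards [self_mem_nhdsWithin, nhdsWithin_le_nhds (Metric.ball_mem_nhds (0 : ℂ) hr0)]
    with x hx hxr
  exact ⟨mk_zero_mem_closure_leafIn hl hr hp hp1 hp2 hx (by simpa using hxr),
    leafClosed_of_snd_eq_zero hl0 hV rfl⟩

/-! ### The irrational case -/

theorem norm_mul_cexp_I (a : ℂ) (t : ℝ) : ‖a * Complex.exp (t * Complex.I)‖ = ‖a‖ := by
  rw [norm_mul, Complex.norm_exp_ofReal_mul_I, mul_one]

theorem exists_eq_mul_cexp_I {a c : ℂ} (h : ‖c‖ = ‖a‖) :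
    ∃ t : ℝ, c = a * Complex.exp (t * Complex.I) := by
  refine ⟨(c.arg - a.arg : ℝ), ?_⟩
  conv_lhs => rw [← Complex.norm_mul_exp_arg_mul_I c]
  have ha := Complex.norm_mul_exp_arg_mul_I a
  have e : Complex.exp (c.arg * Complex.I) = Complex.exp (a.arg * Complex.I) *
      Complex.exp ((c.arg - a.arg : ℝ) * Complex.I) := by
    rw [← Complex.exp_add]
    push_cast
    ring_nf
  rw [h, e, ← mul_assoc, ha]

/-- Imaginary times preserve both moduli. The times `β + 2πn` give the second coordinate exactly,
and the phases of the first are then dense modulo `2π`, because `2πl` and `2π` generate a dense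
subgroup of `ℝ`. -/
theorem exists_linearFlow_near_torus {l : ℝ} (hl : Irrational l) {p q : ℂ × ℂ}
    (h1 : ‖q.1‖ = ‖p.1‖) (h2 : ‖q.2‖ = ‖p.2‖) {ε : ℝ} (hε : 0 < ε) :
    ∃ t : ℝ, ‖(linearFlow l p (t * Complex.I)).1 - q.1‖ < ε ∧
      (linearFlow l p (t * Complex.I)).2 = q.2 := by
  obtain ⟨α, hα⟩ := exists_eq_mul_cexp_I h1
  obtain ⟨β, hβ⟩ := exists_eq_mul_cexp_I h2
  have hcont : Continuous fun x : ℝ => p.1 * Complex.exp (x * Complex.I) := by fun_prop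
  obtain ⟨δ, hδ, hd⟩ := Metric.continuousAt_iff.1 (hcont.continuousAt (x := α)) ε hε
  have hπ : (2 * Real.pi : ℝ) ≠ 0 := by positivity
  have hdense : Dense (AddSubgroup.closure {l * (2 * Real.pi), 2 * Real.pi} : Set ℝ) := by
    rw [dense_addSubgroupClosure_pair_iff, mul_div_cancel_right₀ _ hπ]
    exact hl
  obtain ⟨y, hy, hyd⟩ := hdense.exists_dist_lt (α - l * β) hδ
  obtain ⟨n, k, rfl⟩ := AddSubgroup.mem_closure_pair.1 hy
  refine ⟨β + n * (2 * Real.pi), ?_, ?_⟩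
  · have hdist : dist (l * (β + n * (2 * Real.pi)) + k * (2 * Real.pi)) α < δ := by
      rw [dist_comm]
      convert hyd using 1
      simp only [Real.dist_eq, zsmul_eq_mul]
      ring_nf
    have := hd hdist
    rw [dist_eq_norm, ← hα] at this
    suffices e : (linearFlow l p ((β + n * (2 * Real.pi) : ℝ) * Complex.I)).1 = p.1 * Complex.exp
        ((l * (β + n * (2 * Real.pi)) + k * (2 * Real.pi) : ℝ) * Complex.I) by
      push_cast at e this ⊢
      rwa [e]
    change p.1 * _ = _
    congr 1
    rw [Complex.exp_eq_exp_iff_exists_int]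
    refine ⟨-k, ?_⟩
    push_cast
    ring
  · rw [hβ]
    change p.2 * _ = _
    congr 1
    rw [Complex.exp_eq_exp_iff_exists_int]
    exact ⟨n, by push_cast; ring⟩

/-- A concrete point of the torus missed by the leaf: equality forces `z = 2πi n` and `2 l n = 1 + 2
k`, which is impossible for `n = 0` by parity and makes `l` rational otherwise. -/
theorem linearFlow_ne_neg_fst {l : ℝ} (hl : Irrational l) {p : ℂ × ℂ} (hp1 : p.1 ≠ 0)
    (hp2 : p.2 ≠ 0) (z : ℂ) : linearFlow l p z ≠ (-p.1, p.2) := by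
  intro h
  have e2 : Complex.exp z = 1 := by
    have := congrArg Prod.snd h
    simpa [linearFlow, hp2] using this
  have e1 : Complex.exp (l * z) = -1 := by
    have := congrArg Prod.fst h
    simp only [linearFlow] at this
    exact mul_left_cancel₀ hp1 (by simpa using this)
  obtain ⟨n, hn⟩ := Complex.exp_eq_one_iff.1 e2
  rw [← Complex.exp_pi_mul_I, Complex.exp_eq_exp_iff_exists_int] at e1
  obtain ⟨k, hk⟩ := e1
  have h3 : ((l * n * 2 : ℝ) : ℂ) = ((1 + k * 2 : ℝ) : ℂ) := by
    have : (Real.pi * Complex.I : ℂ) ≠ 0 := by simp [Real.pi_ne_zero]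
    refine mul_right_cancel₀ this ?_
    rw [hn] at hk
    push_cast
    linear_combination hk
  rw [Complex.ofReal_inj] at h3
  by_cases h0 : n = 0
  · subst h0
    have : (1 + k * 2 : ℤ) = 0 := by exact_mod_cast (by simpa using h3.symm : (1 + k * 2 : ℝ) = 0)
    omega
  · refine hl ⟨(1 + k * 2) / (n * 2), ?_⟩
    push_cast
    rw [← h3]
    have : (n : ℝ) ≠ 0 := by exact_mod_cast h0
    field_simp

theorem not_leafClosed_of_irrational {l : ℝ} (hl : Irrational l) {V : Set (ℂ × ℂ)} {r : ℝ}
    (hr : Metric.ball 0 r ⊆ V) {p : ℂ × ℂ} (hp : p ∈ Metric.ball 0 r)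
    (hp1 : p.1 ≠ 0) (hp2 : p.2 ≠ 0) : ¬ LeafClosed (linearField l) V p := by
  intro h
  have hq : (-p.1, p.2) ∈ Metric.ball (0 : ℂ × ℂ) r := by
    rw [mem_ball_zero_prod] at hp ⊢
    simpa using hp
  have hm : (-p.1, p.2) ∈ leafIn (linearField l) V p := by
    refine h _ (hr hq) (fun e => hp2 (congrArg Prod.snd e)) (Metric.mem_closure_iff.2 fun ε hε => ?_)
    obtain ⟨t, ht1, ht2⟩ := exists_linearFlow_near_torus hl (p := p) (q := (-p.1, p.2))
      (by simp) rfl hε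
    refine ⟨linearFlow l p (t * Complex.I), linearFlow_mem_leafIn_of_ball hr hp ?_, ?_⟩
    · rw [mem_ball_zero_prod] at hp ⊢
      have e : (l : ℂ) * (t * Complex.I) = ((l * t : ℝ) : ℂ) * Complex.I := by push_cast; ring
      simp only [linearFlow, e, norm_mul_cexp_I]
      exact hp
    · rw [dist_comm, Prod.dist_eq, ht2, dist_self, dist_eq_norm]
      exact max_lt ht1 hε
  obtain ⟨z, hz⟩ := exists_linearFlow_of_mem_leafIn hm
  exact linearFlow_ne_neg_fst hl hp1 hp2 z hz.symm

/-- For a point off the axes this closed relation meets the axes only at the origin, which keeps the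
leaf closure away from the closed leaves. -/
theorem norm_relation_of_mem_closure {l : ℝ} (hl : 0 < l) {V : Set (ℂ × ℂ)} {p q : ℂ × ℂ}
    (h : q ∈ closure (leafIn (linearField l) V p)) : ‖q.1‖ * ‖p.2‖ ^ l = ‖p.1‖ * ‖q.2‖ ^ l := by
  refine closure_minimal (t := {q : ℂ × ℂ | ‖q.1‖ * ‖p.2‖ ^ l = ‖p.1‖ * ‖q.2‖ ^ l}) ?_
    (isClosed_eq (by fun_prop) (continuous_const.mul
      ((continuous_norm.comp continuous_snd).rpow_const fun _ => Or.inr hl.le))) h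
  intro q hq
  obtain ⟨z, rfl⟩ := exists_linearFlow_of_mem_leafIn hq
  simp only [linearFlow, norm_mul, mem_ofPred_eq, Complex.norm_exp, Complex.re_ofReal_mul]
  rw [Real.mul_rpow (norm_nonneg _) (Real.exp_nonneg _), ← Real.exp_mul]
  ring_nf

theorem not_closuresMeetClosedLeaves_of_irrational {l : ℝ} (hl0 : 0 < l) (hl : Irrational l)
    {V : Set (ℂ × ℂ)} (hV : IsOpen V) (h0 : (0 : ℂ × ℂ) ∈ V) :
    ¬ ClosuresMeetClosedLeaves (linearField l) V := by
  intro h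
  obtain ⟨r, hr0, hr⟩ := Metric.mem_nhds_iff.1 (hV.mem_nhds h0)
  have hd : Tendsto (fun x : ℂ => (x, x)) (𝓝[≠] 0) (𝓝 (0 : ℂ × ℂ)) :=
    (Continuous.tendsto' (f := fun x : ℂ => (x, x)) (by fun_prop) 0 0 rfl).mono_left
      nhdsWithin_le_nhds
  obtain ⟨x, ⟨hx1, hx2⟩, hx0⟩ := ((hd.eventually (h.and (Metric.ball_mem_nhds 0 hr0))).and
    self_mem_nhdsWithin).exists
  have hx0' : x ≠ 0 := hx0
  obtain ⟨q, ⟨⟨hq1, hq2⟩, hqb⟩, hq0⟩ := ((hx1 (fun e => hx0 (congrArg Prod.fst e))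
    (not_leafClosed_of_irrational hl hr hx2 hx0 hx0)).and_eventually
      (nhdsWithin_le_nhds (Metric.ball_mem_nhds 0 hr0))).and_eventually
      self_mem_nhdsWithin |>.exists
  have hrel := norm_relation_of_mem_closure hl0 hq1
  have hx' : ‖x‖ ^ l ≠ 0 := by
    rw [Real.rpow_ne_zero (norm_nonneg _) hl0.ne']; simpa using hx0'
  by_cases h1 : q.1 = 0
  · have : q.2 = 0 := by
      simpa [h1, hx0', Real.rpow_eq_zero (norm_nonneg _) hl0.ne', eq_comm] using hrel
    exact hq0 (Prod.ext h1 this)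
  by_cases h2 : q.2 = 0
  · have : q.1 = 0 := by
      simpa [h2, hx', Real.zero_rpow hl0.ne'] using hrel
    exact h1 this
  exact not_leafClosed_of_irrational hl hr hqb h1 h2 hq2

/-! ### The resonant case -/

/-- The first coordinate is at most `r/4 + r/4 + r/2` in modulus, from `p.1`, from `Re z` by
`e^{ms}|s| ≤ 1` for `s = Re z ≤ 0`, and from the assumed bound on `Im z`. -/
theorem resonantFlow_mem_ball {m : ℕ} (hm : 1 ≤ m) {r : ℝ} {p : ℂ × ℂ} (hp1 : ‖p.1‖ < r / 4)
    (hp2 : ‖p.2‖ < r / 4) (hp3 : ‖p.2‖ ≤ 1) {z : ℂ} (hz : z.re ≤ 0)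
    (hz' : Real.exp (m * z.re) * (‖p.2‖ ^ m * |z.im|) ≤ r / 2) :
    resonantFlow m p z ∈ Metric.ball 0 r := by
  have hm' : (1 : ℝ) ≤ m := by exact_mod_cast hm
  have hr : 0 < r := by have := norm_nonneg p.1; linarith
  have hE : Real.exp (m * z.re) ≤ 1 := Real.exp_le_one_iff.2 (by nlinarith)
  have hE' : Real.exp (m * z.re) * |z.re| ≤ 1 := by
    have h1 : |z.re| ≤ Real.exp (-(m * z.re)) := by
      rw [abs_of_nonpos hz]
      have := Real.add_one_le_exp (-(m * z.re))
      nlinarith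
    calc _ ≤ Real.exp (m * z.re) * Real.exp (-(m * z.re)) := by gcongr
      _ = 1 := by rw [← Real.exp_add]; simp
  have hb : ‖p.2‖ ^ m ≤ ‖p.2‖ := pow_le_of_le_one (norm_nonneg _) hp3 (by omega)
  rw [mem_ball_zero_prod]
  simp only [resonantFlow, norm_mul, Complex.norm_exp]
  constructor
  · have hre : ((m : ℂ) * z).re = m * z.re := by simp
    rw [hre]
    calc Real.exp (m * z.re) * ‖p.1 + p.2 ^ m * z‖
        ≤ Real.exp (m * z.re) * (‖p.1‖ + ‖p.2‖ ^ m * (|z.re| + |z.im|)) := by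
          gcongr
          refine (norm_add_le _ _).trans ?_
          rw [norm_mul, norm_pow]
          gcongr
          exact Complex.norm_le_abs_re_add_abs_im z
      _ = Real.exp (m * z.re) * ‖p.1‖ + ‖p.2‖ ^ m * (Real.exp (m * z.re) * |z.re|) +
          Real.exp (m * z.re) * (‖p.2‖ ^ m * |z.im|) := by ring
      _ ≤ 1 * ‖p.1‖ + ‖p.2‖ * 1 + r / 2 := by gcongr
      _ < r := by linarith
  · calc ‖p.2‖ * Real.exp z.re ≤ ‖p.2‖ * 1 := by gcongr; exact Real.exp_le_one_iff.2 hz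
      _ < r := by linarith

theorem convex_reProdIm {s t : Set ℝ} (hs : Convex ℝ s) (ht : Convex ℝ t) : Convex ℝ (s ×ℂ t) :=
  (hs.linear_preimage Complex.reLm).inter (ht.linear_preimage Complex.imLm)

/-- The time path is L-shaped: along the real axis to `s`, where the solution shrinks, then
vertically to `s + i t`. -/
theorem resonantFlow_mem_leafIn {m : ℕ} (hm : 1 ≤ m) {V : Set (ℂ × ℂ)} {r : ℝ}
    (hr : Metric.ball 0 r ⊆ V) {p : ℂ × ℂ} (hp1 : ‖p.1‖ < r / 4)
    (hp2 : ‖p.2‖ < r / 4) (hp3 : ‖p.2‖ ≤ 1) {s t : ℝ} (hs : s ≤ 0) (ht : 0 ≤ t)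
    (hst : Real.exp (m * s) * (‖p.2‖ ^ m * t) ≤ r / 2) :
    resonantFlow m p ⟨s, t⟩ ∈ leafIn (resonantField m) V p := by
  have hr0 : 0 < r := by have := norm_nonneg p.1; linarith
  have h1 : resonantFlow m p ⟨s, 0⟩ ∈ leafIn (resonantField m) V (resonantFlow m p 0) := by
    refine mem_leafIn_of_convex (hasDerivAt_resonantFlow m p)
      (convex_reProdIm (convex_Iic 0) (convex_singleton 0)) (fun z hz => hr ?_)
      (by simp [Complex.mem_reProdIm])
      (by simpa [Complex.mem_reProdIm] using hs)
    rw [Complex.mem_reProdIm] at hz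
    refine resonantFlow_mem_ball hm hp1 hp2 hp3 hz.1 ?_
    rw [show z.im = 0 from hz.2]
    simpa using (half_pos hr0).le
  have h2 : resonantFlow m p ⟨s, t⟩ ∈ leafIn (resonantField m) V (resonantFlow m p ⟨s, 0⟩) := by
    refine mem_leafIn_of_convex (hasDerivAt_resonantFlow m p)
      (convex_reProdIm (convex_singleton s) (convex_Icc 0 t)) (fun z hz => hr ?_)
      (by simpa [Complex.mem_reProdIm] using ht) (by simpa [Complex.mem_reProdIm] using ht)
    obtain ⟨hz1, hz2⟩ := Complex.mem_reProdIm.1 hz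
    rw [mem_singleton_iff] at hz1
    refine resonantFlow_mem_ball hm hp1 hp2 hp3 (hz1.trans_le hs) (le_trans ?_ hst)
    rw [hz1, abs_of_nonneg hz2.1]
    gcongr
    exact hz2.2
  rw [resonantFlow_zero] at h1
  exact mem_leafIn_trans h1 h2

theorem tendsto_exp_neg_nat_mul {m : ℕ} (hm : 1 ≤ m) :
    Tendsto (fun s : ℝ => Real.exp (-(m * s))) atTop (𝓝 0) := by
  have hm' : (0 : ℝ) < m := by exact_mod_cast hm
  exact Real.tendsto_exp_neg_atTop_nhds_zero.comp (tendsto_id.const_mul_atTop hm')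

theorem tendsto_mul_exp_neg_nat_mul {m : ℕ} (hm : 1 ≤ m) :
    Tendsto (fun s : ℝ => s * Real.exp (-(m * s))) atTop (𝓝 0) := by
  have hm' : (0 : ℝ) < m := by exact_mod_cast hm
  have := ((Real.tendsto_pow_mul_exp_neg_atTop_nhds_zero 1).comp
    (tendsto_id.const_mul_atTop hm')).const_mul (1 / m : ℝ)
  simp only [mul_zero] at this
  refine this.congr fun s => ?_
  simp only [Function.comp, id, pow_one]
  field_simp

/-- Let the real part of the time tend to `-∞` while its imaginary part grows like `e^{ms}`. The
second coordinate tends to `0` and the term `p.2 ^ m * z` keeps the first one away from `0`, so the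
leaf accumulates at a point of `y = 0` which it does not contain. -/
theorem not_leafClosed_resonant {m : ℕ} (hm : 1 ≤ m) {V : Set (ℂ × ℂ)} {r : ℝ}
    (hr : Metric.ball 0 r ⊆ V) {p : ℂ × ℂ} (hp1 : ‖p.1‖ < r / 4)
    (hp2 : ‖p.2‖ < r / 4) (hp3 : ‖p.2‖ ≤ 1) (hb : p.2 ≠ 0) :
    ¬ LeafClosed (resonantField m) V p := by
  intro hc
  have hr0 : 0 < r := by have := norm_nonneg p.1; linarith
  have hm' : (0 : ℝ) < m := by exact_mod_cast hm
  have hb' : 0 < ‖p.2‖ ^ m := pow_pos (norm_pos_iff.2 hb) m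
  -- The constant is chosen so that the limit point `x₀` has modulus `r / 2`.
  set κ : ℝ := r * m / (4 * Real.pi * ‖p.2‖ ^ m) with hκ
  have hκ0 : 0 ≤ κ := by positivity
  set n : ℝ → ℕ := fun s => ⌊κ * Real.exp (m * s)⌋₊ with hn
  -- Multiples of `2π / m` make `exp (m z)` the positive real number `e^{-ms}`, so the phase does
  -- not interfere with the limit.
  set T : ℝ → ℝ := fun s => n s * (2 * Real.pi / m) with hT
  have hlim : Tendsto (fun s => (n s : ℝ) * Real.exp (-(m * s))) atTop (𝓝 κ) := by
    have := (tendsto_nat_floor_mul_div_atTop hκ0).comp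
      (Real.tendsto_exp_atTop.comp (tendsto_id.const_mul_atTop hm'))
    refine this.congr fun s => ?_
    simp [hn, Real.exp_neg, div_eq_mul_inv]
  set x₀ : ℂ := p.2 ^ m * ((κ : ℝ) * (2 * Real.pi / m) * Complex.I) with hx₀
  have hx₀n : ‖x₀‖ = r / 2 := by
    rw [hx₀]
    simp only [norm_mul, norm_pow, norm_div, Complex.norm_real, Complex.norm_I, Complex.norm_natCast,
      Real.norm_eq_abs, abs_of_pos Real.pi_pos, Complex.norm_ofNat, mul_one]
    rw [abs_of_nonneg hκ0, hκ]
    have := Real.pi_pos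
    field_simp
    norm_num
  have hmem : (x₀, (0 : ℂ)) ∈ closure (leafIn (resonantField m) V p) := by
    have hev : ∀ᶠ s : ℝ in atTop,
        resonantFlow m p ⟨-s, T s⟩ ∈ leafIn (resonantField m) V p := by
      filter_upwards [eventually_ge_atTop 0] with s hs
      refine resonantFlow_mem_leafIn hm hr hp1 hp2 hp3 (by linarith) (by positivity) ?_
      have hfl : (n s : ℝ) ≤ κ * Real.exp (m * s) := Nat.floor_le (by positivity)
      have hee : Real.exp (m * -s) * Real.exp (m * s) = 1 := by rw [← Real.exp_add]; simp
      calc Real.exp (m * -s) * (‖p.2‖ ^ m * T s)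
          ≤ Real.exp (m * -s) * (‖p.2‖ ^ m * (κ * Real.exp (m * s) * (2 * Real.pi / m))) := by
            simp only [hT]; gcongr
        _ = (Real.exp (m * -s) * Real.exp (m * s)) * (‖p.2‖ ^ m * κ * (2 * Real.pi / m)) := by ring
        _ = r / 2 := by
            rw [hee, hκ]
            have := Real.pi_pos
            field_simp
            norm_num
        _ ≤ r / 2 := le_rfl
    refine mem_closure_of_tendsto (Tendsto.prodMk_nhds ?_ ?_) hev
    · have h1 := (Complex.continuous_ofReal.tendsto 0).comp (tendsto_exp_neg_nat_mul hm)
      have h2 := (Complex.continuous_ofReal.tendsto 0).comp (tendsto_mul_exp_neg_nat_mul hm)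
      have h3 := (Complex.continuous_ofReal.tendsto κ).comp hlim
      have h4 := ((h1.const_mul p.1).sub (h2.const_mul (p.2 ^ m))).add
        ((h3.mul_const (2 * Real.pi / m * Complex.I : ℂ)).const_mul (p.2 ^ m))
      simp only [Complex.ofReal_zero, mul_zero, sub_zero, zero_add] at h4
      rw [hx₀]
      convert h4 using 2 with s
      · have hexp : Complex.exp (m * (⟨-s, T s⟩ : ℂ)) = (Real.exp (-(m * s)) : ℂ) := by
          rw [Complex.ofReal_exp, Complex.exp_eq_exp_iff_exists_int]
          refine ⟨n s, ?_⟩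
          have hm0 : (m : ℂ) ≠ 0 := by exact_mod_cast hm'.ne'
          rw [Complex.mk_eq_add_mul_I]
          simp only [hT]
          push_cast
          field_simp
        rw [hexp, Complex.mk_eq_add_mul_I]
        simp only [Function.comp, hT]
        push_cast
        ring
      · ring_nf
    · rw [tendsto_zero_iff_norm_tendsto_zero]
      have := (Real.tendsto_exp_neg_atTop_nhds_zero).const_mul ‖p.2‖
      rw [mul_zero] at this
      refine this.congr fun s => ?_
      simp [Complex.norm_exp]
  have hq : (x₀, (0 : ℂ)) ∈ leafIn (resonantField m) V p := by
    refine hc _ (hr ?_) (fun e => ?_) hmem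
    · rw [mem_ball_zero_prod, hx₀n, norm_zero]
      exact ⟨by linarith, hr0⟩
    · have e1 : x₀ = 0 := congrArg Prod.fst e
      rw [e1, norm_zero] at hx₀n
      linarith
  obtain ⟨z, hz⟩ := exists_resonantFlow_of_mem_leafIn hq
  have := congrArg Prod.snd hz
  simp [resonantFlow, hb] at this

theorem eventually_not_leafClosed_resonant {m : ℕ} (hm : 1 ≤ m) {V : Set (ℂ × ℂ)}
    (hV : IsOpen V) (h0 : (0 : ℂ × ℂ) ∈ V) :
    ∀ᶠ p in 𝓝 (0 : ℂ × ℂ), p.2 ≠ 0 → ¬ LeafClosed (resonantField m) V p := by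
  obtain ⟨r, hr0, hr⟩ := Metric.mem_nhds_iff.1 (hV.mem_nhds h0)
  filter_upwards [Metric.ball_mem_nhds 0 (lt_min (by positivity : 0 < r / 4) one_pos)] with p hp hb
  rw [mem_ball_zero_prod] at hp
  exact not_leafClosed_resonant hm hr (hp.1.trans_le (min_le_left _ _))
    (hp.2.trans_le (min_le_left _ _)) (hp.2.le.trans (min_le_right _ _)) hb

theorem atMostOneClosedLeaf_resonant {m : ℕ} (hm : 1 ≤ m) {V : Set (ℂ × ℂ)}
    (hV : IsOpen V) (h0 : (0 : ℂ × ℂ) ∈ V) : AtMostOneClosedLeaf (resonantField m) V := by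
  obtain ⟨r, hr0, hr⟩ := Metric.mem_nhds_iff.1 (hV.mem_nhds h0)
  refine ⟨_, inter_mem (eventually_not_leafClosed_resonant hm hV h0)
    (Metric.ball_mem_nhds 0 hr0), ?_⟩
  rintro p ⟨hp, hpr⟩ q ⟨hq, hqr⟩ hp0 hq0 hpc hqc
  have hp2 : p.2 = 0 := by_contra fun h => hp h hpc
  have hq2 : q.2 = 0 := by_contra fun h => hq h hqc
  have hp1 : p.1 ≠ 0 := fun h => hp0 (Prod.ext h hp2)
  have hq1 : q.1 ≠ 0 := fun h => hq0 (Prod.ext h hq2)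
  have hm0 : (m : ℂ) ≠ 0 := by exact_mod_cast (by omega : m ≠ 0)
  have hflow : linearFlow m p (Complex.log (q.1 / p.1) / m) = q := by
    ext1
    · simp only [linearFlow]
      rw [mul_div_cancel₀ _ hm0, Complex.exp_log (div_ne_zero hq1 hp1), mul_div_cancel₀ _ hp1]
    · simp [linearFlow, hp2, hq2]
  rw [← leafIn_eq_of_mem (p := p) (q := q)]
  rw [leafIn_resonantField_eq hm hp2, ← hflow]
  exact linearFlow_mem_leafIn_of_ball hr hpr (by rwa [hflow])

/-! ### Germs in different cases are not equivalent -/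

/-- The values of (`AllLeavesClosed`, `AtMostOneClosedLeaf`, `ClosuresMeetClosedLeaves`) are
no/no/yes for non-real, no/yes for resonant, yes for rational and no/no/no for irrational; the
entries left open are not needed. -/
theorem not_conjugatesLeaves {i j : PoincareCase} (hij : i ≠ j) {θ η : ℂ × ℂ → ℂ × ℂ}
    (hθ : θ ∈ i.normalForms) (hη : η ∈ j.normalForms)
    (φ : OpenPartialHomeomorph (ℂ × ℂ) (ℂ × ℂ)) : ¬ ConjugatesLeaves φ θ η := by
  have nonReal : ∀ {V : Set (ℂ × ℂ)} {θ : ℂ × ℂ → ℂ × ℂ}, IsOpen V → 0 ∈ V →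
      θ ∈ PoincareCase.nonReal.normalForms → ¬ AllLeavesClosed θ V ∧ ¬ AtMostOneClosedLeaf θ V ∧
        ClosuresMeetClosedLeaves θ V := by
    rintro V _ hV h0 ⟨l, hl, rfl⟩
    obtain ⟨r, hr0, hr⟩ := Metric.mem_nhds_iff.1 (hV.mem_nhds h0)
    refine ⟨not_allLeavesClosed ?_, not_atMostOneClosedLeaf (fun h => hl (by simp [h])) hV h0,
      closuresMeetClosedLeaves_of_im_ne_zero hl hV h0⟩
    filter_upwards [Metric.ball_mem_nhds 0 hr0] with p hp h1 h2
    exact not_leafClosed_of_im_ne_zero hl hr0 hr hp h1 h2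
  have resonant : ∀ {V : Set (ℂ × ℂ)} {θ : ℂ × ℂ → ℂ × ℂ}, IsOpen V → 0 ∈ V →
      θ ∈ PoincareCase.resonant.normalForms →
        ¬ AllLeavesClosed θ V ∧ AtMostOneClosedLeaf θ V := by
    rintro V _ hV h0 ⟨m, hm, rfl⟩
    refine ⟨not_allLeavesClosed ?_, atMostOneClosedLeaf_resonant hm hV h0⟩
    filter_upwards [eventually_not_leafClosed_resonant hm hV h0] with p hp _ h2 using hp h2
  have rational : ∀ {V : Set (ℂ × ℂ)} {θ : ℂ × ℂ → ℂ × ℂ}, IsOpen V →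
      θ ∈ PoincareCase.rational.normalForms → AllLeavesClosed θ V := by
    rintro V _ hV ⟨q, hq, rfl⟩
    refine Eventually.of_forall fun p _ => leafClosed_of_rational (n := q.den) (k := q.num.toNat)
      ?_ q.den_pos ?_ hV p
    · have h1 : (q.num.toNat : ℤ) = q.num := Int.toNat_of_nonneg (Rat.num_nonneg.2 hq.le)
      have h2 : q * q.den = (q.num.toNat : ℚ) := by
        rw [Rat.mul_den_eq_num, ← h1, Int.toNat_natCast, Int.cast_natCast]
      exact_mod_cast congrArg (Rat.cast : ℚ → ℂ) h2
    · have := Rat.num_pos.2 hq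
      omega
  have irrational : ∀ {V : Set (ℂ × ℂ)} {θ : ℂ × ℂ → ℂ × ℂ}, IsOpen V → 0 ∈ V →
      θ ∈ PoincareCase.irrational.normalForms → ¬ AllLeavesClosed θ V ∧
        ¬ AtMostOneClosedLeaf θ V ∧ ¬ ClosuresMeetClosedLeaves θ V := by
    rintro V _ hV h0 ⟨l, hl0, hl, rfl⟩
    obtain ⟨r, hr0, hr⟩ := Metric.mem_nhds_iff.1 (hV.mem_nhds h0)
    refine ⟨not_allLeavesClosed ?_,
      not_atMostOneClosedLeaf (by exact_mod_cast hl0.ne') hV h0,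
      not_closuresMeetClosedLeaves_of_irrational hl0 hl hV h0⟩
    filter_upwards [Metric.ball_mem_nhds 0 hr0] with p hp h1 h2
    exact not_leafClosed_of_irrational hl hr hp h1 h2
  intro h
  have h' := h.symm
  have hs := h.zero_mem
  have ht : (0 : ℂ × ℂ) ∈ φ.target := h'.zero_mem
  have hso := φ.open_source
  have hto := φ.open_target
  have e1 : AllLeavesClosed θ φ.source ↔ AllLeavesClosed η φ.target :=
    ⟨h'.allLeavesClosed, h.allLeavesClosed⟩
  have e2 : AtMostOneClosedLeaf θ φ.source ↔ AtMostOneClosedLeaf η φ.target :=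
    ⟨h'.atMostOneClosedLeaf, h.atMostOneClosedLeaf⟩
  have e3 : ClosuresMeetClosedLeaves θ φ.source ↔ ClosuresMeetClosedLeaves η φ.target :=
    ⟨h'.closuresMeetClosedLeaves, h.closuresMeetClosedLeaves⟩
  cases i <;> cases j <;> first
    | exact hij rfl
    | (first
        | have a := nonReal hso hs hθ
        | have a := resonant hso hs hθ
        | have a := rational hso hθ
        | have a := irrational hso hs hθ
       first
        | have b := nonReal hto ht hη
        | have b := resonant hto ht hη
        | have b := rational hto hη
        | have b := irrational hto ht hη
       tauto)

theorem not_topEquiv_of_ne {i j : PoincareCase} (hij : i ≠ j) {F G : PlaneGerm}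
    (hF : F.InCase i) (hG : G.InCase j) : ¬ F.TopEquiv G := by
  obtain ⟨θ, hθ, hFθ⟩ := hF
  obtain ⟨η, hη, hGη⟩ := hG
  rintro ⟨φ, h0, h00, hs, ht, h⟩
  refine not_conjugatesLeaves hij hθ hη φ ⟨h0, h00, fun p hp => ?_⟩
  rw [← hFθ.leafIn_eq hs, ← hGη.leafIn_eq ht, h p hp]

/-! ### Trace leaves of the linear fields -/

theorem linearFlow_mem_sphere3 {l : ℂ} {p : ℂ × ℂ} {z : ℂ} :
    linearFlow l p z ∈ sphere3 ↔
      (‖p.1‖ * Real.exp (l * z).re) ^ 2 + (‖p.2‖ * Real.exp z.re) ^ 2 = 1 := by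
  change ‖_‖ ^ 2 + ‖_‖ ^ 2 = (1 : ℝ) ↔ _
  simp [linearFlow, Complex.norm_exp]

theorem sphere3_eq (p : sphere3) : ‖(p : ℂ × ℂ).1‖ ^ 2 + ‖(p : ℂ × ℂ).2‖ ^ 2 = 1 := p.2

theorem norm_snd_of_mem_circleX {p : sphere3} (hp : p ∈ circleX) : ‖(p : ℂ × ℂ).2‖ = 1 := by
  have h := sphere3_eq p
  rw [show (p : ℂ × ℂ).1 = 0 from hp, norm_zero, zero_pow two_ne_zero, zero_add] at h
  exact (pow_eq_one_iff_of_nonneg (norm_nonneg _) two_ne_zero).1 h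

theorem norm_fst_of_mem_circleY {p : sphere3} (hp : p ∈ circleY) : ‖(p : ℂ × ℂ).1‖ = 1 := by
  have h := sphere3_eq p
  rw [show (p : ℂ × ℂ).2 = 0 from hp, norm_zero, zero_pow two_ne_zero, add_zero] at h
  exact (pow_eq_one_iff_of_nonneg (norm_nonneg _) two_ne_zero).1 h

theorem traceLeaf_linearField_of_convex {l : ℂ} {p : sphere3} {S : Set ℂ} (hS : Convex ℝ S)
    (h : ∀ z, linearFlow l p z ∈ sphere3 ↔ z ∈ S) :
    traceLeaf (linearField l) p = {q : sphere3 | ∃ z, (q : ℂ × ℂ) = linearFlow l p z} := by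
  ext q
  refine ⟨exists_linearFlow_of_mem_leafIn, ?_⟩
  rintro ⟨z, hz⟩
  change (q : ℂ × ℂ) ∈ leafIn _ _ _
  have := mem_leafIn_of_convex (A := sphere3) (hasDerivAt_linearFlow l p) hS
    (fun z hz => (h z).2 hz) (z₀ := 0) (z₁ := z) ((h 0).1 (by simp)) ((h z).1 (hz ▸ q.2))
  rwa [linearFlow_zero, ← hz] at this

theorem convex_setOf_re_mul_eq_zero (l : ℂ) : Convex ℝ {z : ℂ | (l * z).re = 0} :=
  (convex_singleton (0 : ℝ)).linear_preimage (Complex.reLm ∘ₗ LinearMap.mulLeft ℝ l)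

theorem traceLeaf_linearField_circleX (l : ℂ) {p : sphere3} (hp : p ∈ circleX) :
    traceLeaf (linearField l) p = circleX := by
  have hp1 : (p : ℂ × ℂ).1 = 0 := hp
  have hn := norm_snd_of_mem_circleX hp
  rw [traceLeaf_linearField_of_convex (convex_setOf_re_mul_eq_zero 1) fun z => ?_]
  · ext q
    constructor
    · rintro ⟨z, hz⟩
      change (q : ℂ × ℂ).1 = 0
      simp [hz, linearFlow, hp1]
    · intro hq
      obtain ⟨t, ht⟩ := exists_eq_mul_cexp_I ((norm_snd_of_mem_circleX hq).trans hn.symm)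
      refine ⟨t * Complex.I, Prod.ext ?_ ht⟩
      simpa [linearFlow, hp1] using show (q : ℂ × ℂ).1 = 0 from hq
  · rw [linearFlow_mem_sphere3, hn, hp1]
    simp [pow_eq_one_iff_of_nonneg (Real.exp_nonneg _)]

theorem traceLeaf_linearField_circleY {l : ℂ} (hl : l ≠ 0) {p : sphere3} (hp : p ∈ circleY) :
    traceLeaf (linearField l) p = circleY := by
  have hp2 : (p : ℂ × ℂ).2 = 0 := hp
  have hn := norm_fst_of_mem_circleY hp
  rw [traceLeaf_linearField_of_convex (convex_setOf_re_mul_eq_zero l) fun z => ?_]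
  · ext q
    constructor
    · rintro ⟨z, hz⟩
      change (q : ℂ × ℂ).2 = 0
      simp [hz, linearFlow, hp2]
    · intro hq
      obtain ⟨t, ht⟩ := exists_eq_mul_cexp_I ((norm_fst_of_mem_circleY hq).trans hn.symm)
      refine ⟨t * Complex.I / l, Prod.ext ?_ ?_⟩
      · simp only [linearFlow]
        rw [mul_div_cancel₀ _ hl, ht]
      · simpa [linearFlow, hp2] using show (q : ℂ × ℂ).2 = 0 from hq
  · rw [linearFlow_mem_sphere3, hn, hp2]
    simp only [one_mul, norm_zero, zero_mul, ne_eq, OfNat.ofNat_ne_zero, not_false_eq_true,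
      zero_pow, add_zero, mem_ofPred_eq]
    rw [pow_eq_one_iff_of_nonneg (Real.exp_nonneg _) two_ne_zero, Real.exp_eq_one_iff]

/-- For `l > 0` both moduli scale in the same direction with `Re z`, so the sphere is left as soon
as `Re z ≠ 0`. -/
theorem linearFlow_mem_sphere3_iff_of_pos {l : ℝ} (hl : 0 < l) (p : sphere3) (z : ℂ) :
    linearFlow l p z ∈ sphere3 ↔ z.re = 0 := by
  rw [linearFlow_mem_sphere3, Complex.re_ofReal_mul]
  have hp := sphere3_eq p
  set a := ‖(p : ℂ × ℂ).1‖
  set b := ‖(p : ℂ × ℂ).2‖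
  have key : ∀ {x y : ℝ}, a ^ 2 * (x ^ 2 - 1) + b ^ 2 * (y ^ 2 - 1) = 0 → 0 < x → 0 < y →
      ¬ (1 < x ∧ 1 < y) ∧ ¬ (x < 1 ∧ y < 1) := by
    intro x y h hx hy
    constructor
    · rintro ⟨h1, h2⟩
      have h3 : 0 < x ^ 2 - 1 := by nlinarith
      have h4 : 0 < y ^ 2 - 1 := by nlinarith
      have h5 := mul_nonneg (sq_nonneg a) h3.le
      have h6 := mul_nonneg (sq_nonneg b) h4.le
      have ha : a ^ 2 = 0 := by
        by_contra hne
        have : 0 < a ^ 2 * (x ^ 2 - 1) := mul_pos (lt_of_le_of_ne (sq_nonneg _) (Ne.symm hne)) h3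
        linarith
      have hb : b ^ 2 * (y ^ 2 - 1) = 0 := by rw [ha] at h; linarith
      rw [ha, zero_add] at hp
      rw [hp] at hb
      linarith
    · rintro ⟨h1, h2⟩
      have h3 : 0 < 1 - x ^ 2 := by nlinarith
      have h4 : 0 < 1 - y ^ 2 := by nlinarith
      have h5 := mul_nonneg (sq_nonneg a) h3.le
      have h6 := mul_nonneg (sq_nonneg b) h4.le
      have ha : a ^ 2 = 0 := by
        by_contra hne
        have : 0 < a ^ 2 * (1 - x ^ 2) := mul_pos (lt_of_le_of_ne (sq_nonneg _) (Ne.symm hne)) h3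
        linarith
      have hb : b ^ 2 * (1 - y ^ 2) = 0 := by rw [ha] at h; linarith
      rw [ha, zero_add] at hp
      rw [hp] at hb
      linarith
  constructor
  · intro h
    obtain ⟨h1, h2⟩ := key (x := Real.exp (l * z.re)) (y := Real.exp z.re)
      (by linear_combination h - hp) (Real.exp_pos _) (Real.exp_pos _)
    simp only [Real.one_lt_exp_iff, Real.exp_lt_one_iff] at h1 h2
    rcases lt_trichotomy z.re 0 with h3 | h3 | h3
    · exact absurd ⟨mul_neg_of_pos_of_neg hl h3, h3⟩ h2
    · exact h3
    · exact absurd ⟨mul_pos hl h3, h3⟩ h1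
  · intro h
    simp [h, hp]

theorem traceLeaf_linearField_of_pos {l : ℝ} (hl : 0 < l) (p : sphere3) :
    traceLeaf (linearField l) p =
      {q : sphere3 | ∃ t : ℝ, (q : ℂ × ℂ) = linearFlow l p (t * Complex.I)} := by
  rw [traceLeaf_linearField_of_convex (convex_setOf_re_mul_eq_zero 1) fun z => ?_]
  · ext q
    refine ⟨?_, fun ⟨t, ht⟩ => ⟨_, ht⟩⟩
    rintro ⟨z, hz⟩
    have h := (linearFlow_mem_sphere3_iff_of_pos hl p z).1 (hz ▸ q.2)
    refine ⟨z.im, ?_⟩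
    rw [hz]
    congr 1
    apply Complex.ext <;> simp [h]
  · rw [linearFlow_mem_sphere3_iff_of_pos hl]
    simp

theorem isClosed_circleX : IsClosed circleX :=
  isClosed_singleton.preimage (continuous_fst.comp continuous_subtype_val)

theorem isClosed_circleY : IsClosed circleY :=
  isClosed_singleton.preimage (continuous_snd.comp continuous_subtype_val)

theorem circleX_nonempty : circleX.Nonempty := ⟨⟨(0, 1), by simp [sphere3]⟩, rfl⟩

theorem circleY_nonempty : circleY.Nonempty := ⟨⟨(1, 0), by simp [sphere3]⟩, rfl⟩

theorem closedTraceLeaves_eq_pair {θ : ℂ × ℂ → ℂ × ℂ} (hX : ∀ p ∈ circleX, traceLeaf θ p = circleX)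
    (hY : ∀ p ∈ circleY, traceLeaf θ p = circleY)
    (h : ∀ p, p ∉ circleX → p ∉ circleY → ¬ IsClosed (traceLeaf θ p)) :
    closedTraceLeaves θ = {circleX, circleY} := by
  ext L
  simp only [mem_insert_iff, mem_singleton_iff]
  constructor
  · rintro ⟨⟨p, rfl⟩, hc⟩
    by_cases h1 : p ∈ circleX
    · exact Or.inl (hX p h1)
    by_cases h2 : p ∈ circleY
    · exact Or.inr (hY p h2)
    exact absurd hc (h p h1 h2)
  · rintro (rfl | rfl)
    · obtain ⟨p, hp⟩ := circleX_nonempty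
      exact ⟨⟨p, hX p hp⟩, isClosed_circleX⟩
    · obtain ⟨p, hp⟩ := circleY_nonempty
      exact ⟨⟨p, hY p hp⟩, isClosed_circleY⟩

/-! #### The rational case -/

/-- With `t` as time parameter, `2π` times the denominator is a period, so the leaf is the image of
a compact interval. -/
theorem isClosed_traceLeaf_of_rational {r : ℚ} (hr : 0 < r) (p : sphere3) :
    IsClosed (traceLeaf (linearField r) p) := by
  have hr' : (0 : ℝ) < r := by exact_mod_cast hr
  have e := traceLeaf_linearField_of_pos hr' p
  rw [Complex.ofReal_ratCast] at e
  rw [e]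
  have hper : Function.Periodic (fun t : ℝ => linearFlow r p (t * Complex.I))
      (r.den * (2 * Real.pi)) := by
    intro t
    have h1 : (r : ℂ) * r.den = r.num := by exact_mod_cast congrArg (Rat.cast : ℚ → ℂ) r.mul_den_eq_num
    simp only [linearFlow]
    congr 2
    · rw [Complex.exp_eq_exp_iff_exists_int]
      refine ⟨r.num, ?_⟩
      push_cast
      linear_combination (2 * Real.pi * Complex.I) * h1
    · rw [Complex.exp_eq_exp_iff_exists_int]
      exact ⟨r.den, by push_cast; ring⟩
  have hpos : 0 < r.den * (2 * Real.pi) := by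
    have : (0 : ℝ) < r.den := by exact_mod_cast r.den_pos
    positivity
  have hc : IsClosed (range fun t : ℝ => linearFlow r p (t * Complex.I)) := by
    rw [← hper.image_Icc hpos 0]
    exact (isCompact_Icc.image ((continuous_linearFlow r p).comp (by fun_prop))).isClosed
  convert hc.preimage continuous_subtype_val using 1
  ext q
  simp [eq_comm]

/-! #### The irrational case -/

theorem closure_traceLeaf_of_irrational {l : ℝ} (hl0 : 0 < l) (hl : Irrational l) (p : sphere3) :
    closure (traceLeaf (linearField l) p) =
      {q : sphere3 | ‖(q : ℂ × ℂ).1‖ = ‖(p : ℂ × ℂ).1‖} := by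
  rw [traceLeaf_linearField_of_pos hl0]
  refine Subset.antisymm (closure_minimal ?_ ?_) ?_
  · rintro q ⟨t, ht⟩
    have e : (l : ℂ) * (t * Complex.I) = ((l * t : ℝ) : ℂ) * Complex.I := by push_cast; ring
    change ‖_‖ = _
    simp only [ht, linearFlow, e, norm_mul_cexp_I]
  · exact isClosed_eq (by fun_prop) (by fun_prop)
  · intro q hq
    have hq1 : ‖(q : ℂ × ℂ).1‖ = ‖(p : ℂ × ℂ).1‖ := hq
    have hq2 : ‖(q : ℂ × ℂ).2‖ = ‖(p : ℂ × ℂ).2‖ := by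
      have h1 := sphere3_eq p
      have h2 := sphere3_eq q
      rw [hq1] at h2
      exact (sq_eq_sq₀ (norm_nonneg _) (norm_nonneg _)).1 (by linarith)
    refine Metric.mem_closure_iff.2 fun ε hε => ?_
    obtain ⟨t, ht1, ht2⟩ := exists_linearFlow_near_torus hl hq1 hq2 hε
    refine ⟨⟨linearFlow l p (t * Complex.I),
      (linearFlow_mem_sphere3_iff_of_pos hl0 p _).2 (by simp)⟩, ⟨t, rfl⟩, ?_⟩
    rw [Subtype.dist_eq, dist_comm, Prod.dist_eq, ht2, dist_self, dist_eq_norm]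
    exact max_lt ht1 hε

theorem not_isClosed_traceLeaf_of_irrational {l : ℝ} (hl0 : 0 < l) (hl : Irrational l)
    {p : sphere3} (hX : p ∉ circleX) (hY : p ∉ circleY) :
    ¬ IsClosed (traceLeaf (linearField l) p) := by
  intro h
  have h1 := closure_traceLeaf_of_irrational hl0 hl p
  rw [h.closure_eq] at h1
  have hm : (⟨(-(p : ℂ × ℂ).1, (p : ℂ × ℂ).2), by simpa [sphere3] using sphere3_eq p⟩ : sphere3) ∈
      traceLeaf (linearField l) p := by
    rw [h1]
    change ‖_‖ = _
    simp
  obtain ⟨z, hz⟩ := exists_linearFlow_of_mem_leafIn hm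
  exact linearFlow_ne_neg_fst hl hX hY z hz.symm

/-! #### The non-real case -/

/-- Intermediate values: an unbounded continuous phase takes every value modulo `2π` arbitrarily
late. This is how a spiralling leaf accumulates at every point of a limit circle. -/
theorem frequently_eq_add_int_mul {h : ℝ → ℝ} (hc : Continuous h)
    (hT : Tendsto h atTop atTop ∨ Tendsto h atTop atBot) (α : ℝ) :
    ∃ᶠ w in atTop, ∃ n : ℤ, h w = α + n * (2 * Real.pi) := by
  have key : ∀ {h : ℝ → ℝ}, Continuous h → Tendsto h atTop atTop → ∀ α : ℝ,
      ∃ᶠ w in atTop, ∃ n : ℤ, h w = α + n * (2 * Real.pi) := by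
    intro h hc hT α
    refine frequently_atTop.2 fun N => ?_
    obtain ⟨n, hn⟩ := exists_int_gt ((h N - α) / (2 * Real.pi))
    rw [div_lt_iff₀ (by positivity)] at hn
    obtain ⟨M, hM, hMN⟩ := ((hT.eventually_ge_atTop (α + n * (2 * Real.pi))).and
      (eventually_ge_atTop N)).exists
    obtain ⟨w, hw, hw'⟩ := intermediate_value_Icc hMN hc.continuousOn
      (show α + n * (2 * Real.pi) ∈ Icc (h N) (h M) from ⟨by linarith, hM⟩)
    exact ⟨w, hw.1, n, hw'⟩
  rcases hT with hT | hT
  · exact key hc hT α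
  · refine (key hc.neg (tendsto_neg_atBot_atTop.comp hT) (-α)).mono ?_
    rintro w ⟨n, hn⟩
    refine ⟨-n, ?_⟩
    push_cast
    simp only [Pi.neg_apply] at hn
    linarith

/-- The curve of times at which the flow line of `linearField l` through a point with coordinates
of norm `a` and `b` lies on the unit sphere. -/
noncomputable def sphereTime (l : ℂ) (a b : ℝ) (w : ℝ) : ℂ :=
  -- The parameter is `w = log (|x|² / |y|²)`, so on the sphere `|x|² = 1 / (1 + e^{-w})` and `|y|²
  -- = 1 / (1 + e^w)`. These force `Re (l z) = u` and `Re z = v`, which determine `z` because `l.im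
  -- ≠ 0`.
  let u := -(1 / 2) * Real.log (1 + Real.exp (-w)) - Real.log a
  let v := -(1 / 2) * Real.log (1 + Real.exp w) - Real.log b
  ⟨v, (l.re * v - u) / l.im⟩

theorem sphereTime_re (l : ℂ) (a b w : ℝ) :
    (sphereTime l a b w).re = -(1 / 2) * Real.log (1 + Real.exp w) - Real.log b := rfl

theorem mul_sphereTime_re {l : ℂ} (hl : l.im ≠ 0) (a b w : ℝ) :
    (l * sphereTime l a b w).re = -(1 / 2) * Real.log (1 + Real.exp (-w)) - Real.log a := by
  simp only [sphereTime, Complex.mul_re]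
  field_simp
  ring

/-- In this form the phase of the first coordinate is visibly unbounded as `w → ∞`: `Re z` tends to
`-∞` while `Re (l z)` converges. -/
theorem mul_sphereTime_im {l : ℂ} (hl : l.im ≠ 0) (a b w : ℝ) :
    (l * sphereTime l a b w).im = ((l.im ^ 2 + l.re ^ 2) * (sphereTime l a b w).re -
      l.re * (l * sphereTime l a b w).re) / l.im := by
  rw [Complex.mul_im, Complex.mul_re]
  field_simp
  ring_nf

theorem contDiff_sphereTime (l : ℂ) (a b : ℝ) : ContDiff ℝ 1 (sphereTime l a b) := by
  have h1 : ContDiff ℝ 1 fun w : ℝ => -(1 / 2) * Real.log (1 + Real.exp (-w)) - Real.log a :=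
    (contDiff_const.mul (ContDiff.log (by fun_prop) fun w => by positivity)).sub contDiff_const
  have h2 : ContDiff ℝ 1 fun w : ℝ => -(1 / 2) * Real.log (1 + Real.exp w) - Real.log b :=
    (contDiff_const.mul (ContDiff.log (by fun_prop) fun w => by positivity)).sub contDiff_const
  have h3 := Complex.equivRealProdCLM.symm.contDiff.comp
    (h2.prodMk (((contDiff_const (c := l.re)).mul h2 |>.sub h1).div_const l.im))
  suffices e : sphereTime l a b = _ from e ▸ h3
  funext w
  simp only [sphereTime, Function.comp, Complex.mk_eq_add_mul_I, Complex.equivRealProdCLM_symm_apply]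

theorem mul_exp_half_log {a x : ℝ} (ha : 0 < a) (hx : 0 < x) :
    (a * Real.exp (-(1 / 2) * Real.log x - Real.log a)) ^ 2 = x⁻¹ := by
  rw [mul_pow, ← Real.exp_nat_mul, mul_sub, Real.exp_sub]
  have e1 : Real.exp ((2 : ℕ) * (-(1 / 2) * Real.log x)) = x⁻¹ := by
    rw [← Real.exp_log (inv_pos.2 hx), Real.log_inv]
    push_cast
    ring_nf
  have e2 : Real.exp ((2 : ℕ) * Real.log a) = a ^ 2 := by
    rw [Real.exp_nat_mul, Real.exp_log ha]
  rw [e1, e2]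
  field_simp

theorem one_add_exp_inv_add (w : ℝ) : (1 + Real.exp (-w))⁻¹ + (1 + Real.exp w)⁻¹ = 1 := by
  rw [Real.exp_neg]
  have := Real.exp_pos w
  field_simp
  ring

theorem linearFlow_sphereTime_mem {l : ℂ} (hl : l.im ≠ 0) {p : ℂ × ℂ} (h1 : p.1 ≠ 0) (h2 : p.2 ≠ 0)
    (w : ℝ) : linearFlow l p (sphereTime l ‖p.1‖ ‖p.2‖ w) ∈ sphere3 := by
  rw [linearFlow_mem_sphere3, mul_sphereTime_re hl, sphereTime_re,
    mul_exp_half_log (norm_pos_iff.2 h1) (by positivity),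
    mul_exp_half_log (norm_pos_iff.2 h2) (by positivity), one_add_exp_inv_add]

theorem log_eq_of_sq_eq_inv {a x u : ℝ} (ha : 0 < a) (hx : 0 < x)
    (h : (a * Real.exp u) ^ 2 = x⁻¹) : u = -(1 / 2) * Real.log x - Real.log a := by
  rw [← mul_exp_half_log ha hx, sq_eq_sq₀ (by positivity) (by positivity)] at h
  exact Real.exp_injective (mul_left_cancel₀ ha.ne' h)

theorem exists_eq_sphereTime {l : ℂ} (hl : l.im ≠ 0) {p : ℂ × ℂ} (h1 : p.1 ≠ 0) (h2 : p.2 ≠ 0)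
    {z : ℂ} (hz : linearFlow l p z ∈ sphere3) : ∃ w, z = sphereTime l ‖p.1‖ ‖p.2‖ w := by
  rw [linearFlow_mem_sphere3] at hz
  have ha := norm_pos_iff.2 h1
  have hb := norm_pos_iff.2 h2
  set s := (‖p.1‖ * Real.exp (l * z).re) ^ 2 with hs
  set t := (‖p.2‖ * Real.exp z.re) ^ 2 with ht
  have hs0 : 0 < s := by positivity
  have ht0 : 0 < t := by positivity
  refine ⟨Real.log (s / t), ?_⟩
  have e1 : Real.exp (Real.log (s / t)) = s / t := Real.exp_log (by positivity)
  have e2 : s = (1 + Real.exp (-Real.log (s / t)))⁻¹ := by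
    rw [Real.exp_neg, e1]
    field_simp
    linarith
  have e3 : t = (1 + Real.exp (Real.log (s / t)))⁻¹ := by
    rw [e1]
    field_simp
    linarith
  have u := log_eq_of_sq_eq_inv ha (by positivity) (hs.symm.trans e2)
  have v := log_eq_of_sq_eq_inv hb (by positivity) (ht.symm.trans e3)
  rw [← mul_sphereTime_re hl ‖p.1‖ ‖p.2‖] at u
  rw [← sphereTime_re l ‖p.1‖ ‖p.2‖] at v
  refine Complex.ext v ?_
  rw [Complex.mul_re, Complex.mul_re, v] at u
  exact mul_left_cancel₀ hl (by linarith)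

theorem traceLeaf_linearField_of_im_ne_zero {l : ℂ} (hl : l.im ≠ 0) {p : sphere3}
    (hX : p ∉ circleX) (hY : p ∉ circleY) :
    traceLeaf (linearField l) p = {q : sphere3 | ∃ z, (q : ℂ × ℂ) = linearFlow l p z} := by
  ext q
  refine ⟨exists_linearFlow_of_mem_leafIn, ?_⟩
  rintro ⟨z, hz⟩
  obtain ⟨w₁, hw₁⟩ := exists_eq_sphereTime hl hX hY (z := z) (hz ▸ q.2)
  obtain ⟨w₀, hw₀⟩ := exists_eq_sphereTime hl hX hY (z := 0) (by simp)
  have := mem_leafIn_of_flow (A := sphere3) (hasDerivAt_linearFlow l p)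
    (contDiff_sphereTime l ‖(p : ℂ × ℂ).1‖ ‖(p : ℂ × ℂ).2‖) (linearFlow_sphereTime_mem hl hX hY) w₀ w₁
  rwa [← hw₀, ← hw₁, linearFlow_zero, ← hz] at this

theorem tendsto_log_one_add_exp_neg :
    Tendsto (fun w : ℝ => Real.log (1 + Real.exp (-w))) atTop (𝓝 0) := by
  have h := (tendsto_const_nhds (x := (1 : ℝ))).add Real.tendsto_exp_neg_atTop_nhds_zero
  rw [add_zero] at h
  simpa using h.log one_ne_zero

theorem tendsto_log_one_add_exp :
    Tendsto (fun w : ℝ => Real.log (1 + Real.exp w)) atTop atTop :=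
  Real.tendsto_log_atTop.comp (tendsto_atTop_add_const_left _ _ Real.tendsto_exp_atTop)

theorem exists_linearFlow_near_circleY {l : ℂ} (hl : l.im ≠ 0) {p : ℂ × ℂ} (h1 : p.1 ≠ 0)
    (h2 : p.2 ≠ 0) {x : ℂ} (hx : ‖x‖ = 1) {ε : ℝ} (hε : 0 < ε) :
    ∃ z, linearFlow l p z ∈ sphere3 ∧ dist (x, (0 : ℂ)) (linearFlow l p z) < ε := by
  have ha := norm_pos_iff.2 h1
  have hb := norm_pos_iff.2 h2
  set Z := sphereTime l ‖p.1‖ ‖p.2‖ with hZ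
  have hZc : Continuous Z := (contDiff_sphereTime _ _ _).continuous
  have hv : Tendsto (fun w => (Z w).re) atTop atBot := by
    have := tendsto_log_one_add_exp.const_mul_atTop_of_neg (by norm_num : -(1 / 2 : ℝ) < 0)
    exact tendsto_atBot_add_const_right _ (-Real.log ‖p.2‖) this
  have hu : Tendsto (fun w => (l * Z w).re) atTop (𝓝 (-Real.log ‖p.1‖)) := by
    have := (tendsto_log_one_add_exp_neg.const_mul (-(1 / 2 : ℝ))).sub_const (Real.log ‖p.1‖)
    rw [mul_zero, zero_sub] at this
    exact this.congr fun w => (mul_sphereTime_re hl _ _ w).symm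
  have him : Tendsto (fun w => (l * Z w).im) atTop atTop ∨
      Tendsto (fun w => (l * Z w).im) atTop atBot := by
    have hsq : 0 < l.im ^ 2 + l.re ^ 2 := by positivity
    have h3 : Tendsto (fun w => (l.im ^ 2 + l.re ^ 2) * (Z w).re - l.re * (l * Z w).re) atTop
        atBot := by
      simp only [sub_eq_add_neg]
      exact (hv.const_mul_atBot hsq).atBot_add (hu.const_mul l.re).neg
    have h4 : (fun w => (l * Z w).im) = fun w =>
        ((l.im ^ 2 + l.re ^ 2) * (Z w).re - l.re * (l * Z w).re) * (l.im)⁻¹ := by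
      ext w
      rw [mul_sphereTime_im hl, div_eq_mul_inv]
    rw [h4]
    rcases hl.lt_or_gt with h | h
    · exact Or.inl (h3.atBot_mul_const_of_neg (inv_lt_zero.2 h))
    · exact Or.inr (h3.atBot_mul_const (inv_pos.2 h))
  have hfreq := frequently_eq_add_int_mul (h := fun w => (l * Z w).im) (by fun_prop) him
    (x.arg - p.1.arg)
  have hlim1 : Tendsto (fun w => ‖x * (‖p.1‖ * Real.exp (l * Z w).re : ℝ) - x‖) atTop (𝓝 0) := by
    have h5 := (hu.rexp).const_mul ‖p.1‖
    rw [Real.exp_neg, Real.exp_log ha, mul_inv_cancel₀ ha.ne'] at h5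
    have h6 := (((Complex.continuous_ofReal.tendsto _).comp h5).const_mul x).sub_const x
    simpa using h6.norm
  have hlim2 : Tendsto (fun w => ‖p.2‖ * Real.exp (Z w).re) atTop (𝓝 0) := by
    simpa using (Real.tendsto_exp_atBot.comp hv).const_mul ‖p.2‖
  obtain ⟨w, ⟨n, hn⟩, hw1, hw2⟩ := (hfreq.and_eventually
    ((hlim1.eventually_lt_const hε).and (hlim2.eventually_lt_const hε))).exists
  refine ⟨Z w, linearFlow_sphereTime_mem hl h1 h2 w, ?_⟩
  -- At the chosen `w` the first coordinate has exactly the argument of `x`, so only its modulus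
  -- still has to converge.
  have e : p.1 * Complex.exp (l * Z w) = x * (‖p.1‖ * Real.exp (l * Z w).re : ℝ) := by
    have e1 : l * Z w = ((l * Z w).re : ℂ) + (l * Z w).im * Complex.I :=
      (Complex.re_add_im _).symm
    have e2 : Complex.exp (p.1.arg * Complex.I) * Complex.exp ((l * Z w).im * Complex.I) =
        Complex.exp (x.arg * Complex.I) := by
      rw [← Complex.exp_add, Complex.exp_eq_exp_iff_exists_int]
      refine ⟨n, ?_⟩
      rw [hn]
      push_cast
      ring
    have e3 := Complex.norm_mul_exp_arg_mul_I p.1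
    have e4 := Complex.norm_mul_exp_arg_mul_I x
    rw [hx, Complex.ofReal_one, one_mul] at e4
    rw [e4] at e2
    conv_lhs => rw [e1, Complex.exp_add, ← e3]
    rw [← e2]
    push_cast
    ring
  rw [dist_comm, Prod.dist_eq]
  refine max_lt ?_ ?_
  · rw [dist_eq_norm]
    simpa only [linearFlow, e] using hw1
  · simpa [linearFlow, Complex.norm_exp] using hw2

/-- Exchanging the coordinates turns `l` into `l⁻¹` and the time `z` into `l⁻¹ * z`, and `l⁻¹` is
again non-real. -/
theorem exists_linearFlow_near_circleX {l : ℂ} (hl : l.im ≠ 0) {p : ℂ × ℂ} (h1 : p.1 ≠ 0)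
    (h2 : p.2 ≠ 0) {y : ℂ} (hy : ‖y‖ = 1) {ε : ℝ} (hε : 0 < ε) :
    ∃ z, linearFlow l p z ∈ sphere3 ∧ dist ((0 : ℂ), y) (linearFlow l p z) < ε := by
  have hl0 : l ≠ 0 := fun h => hl (by simp [h])
  have hl' : (l⁻¹).im ≠ 0 := by simp [Complex.inv_im, hl, hl0]
  obtain ⟨z, hz1, hz2⟩ := exists_linearFlow_near_circleY (p := p.swap) hl' h2 h1 hy hε
  have e : linearFlow l p (l⁻¹ * z) = (linearFlow l⁻¹ p.swap z).swap := by
    simp [linearFlow, hl0]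
  refine ⟨l⁻¹ * z, ?_, ?_⟩
  · rw [e]
    change ‖_‖ ^ 2 + ‖_‖ ^ 2 = (1 : ℝ)
    rw [add_comm]
    exact hz1
  · rw [e, Prod.dist_eq, max_comm]
    exact hz2

/-- If the time can be read off continuously from the point near `q`, times of orbit points tending
to `q` converge, and `q` is reached at the limit time. -/
theorem mem_of_mem_closure_range {Φ : ℂ → ℂ × ℂ} (hΦ : Continuous Φ) {Z : ℂ × ℂ → ℂ}
    {q : sphere3} (hZ : ContinuousAt Z q) (hZΦ : ∀ z, Z (Φ z) = z)
    (hq : q ∈ closure {x : sphere3 | ∃ z, (x : ℂ × ℂ) = Φ z}) : ∃ z, (q : ℂ × ℂ) = Φ z := by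
  refine ⟨Z q, ?_⟩
  have h1 : Tendsto (fun x : sphere3 => Φ (Z x)) (𝓝 q) (𝓝 (Φ (Z q))) :=
    (hΦ.tendsto _).comp (hZ.comp continuous_subtype_val.continuousAt)
  refine tendsto_nhds_unique_of_frequently_eq (continuous_subtype_val.tendsto q) h1
    ((mem_closure_iff_frequently.1 hq).mono ?_)
  rintro x ⟨z, hz⟩
  rw [hz, hZΦ]

theorem closure_traceLeaf_of_im_ne_zero {l : ℂ} (hl : l.im ≠ 0) {p : sphere3}
    (hX : p ∉ circleX) (hY : p ∉ circleY) :
    closure (traceLeaf (linearField l) p) =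
      traceLeaf (linearField l) p ∪ (circleX ∪ circleY) := by
  have hp1 : (p : ℂ × ℂ).1 ≠ 0 := hX
  have hp2 : (p : ℂ × ℂ).2 ≠ 0 := hY
  have e := traceLeaf_linearField_of_im_ne_zero hl hX hY
  refine Subset.antisymm ?_ (union_subset subset_closure (union_subset ?_ ?_))
  · intro q hq
    by_cases h1 : q ∈ circleX
    · exact Or.inr (Or.inl h1)
    by_cases h2 : q ∈ circleY
    · exact Or.inr (Or.inr h2)
    refine Or.inl ?_
    have hq1 : (q : ℂ × ℂ).1 ≠ 0 := h1
    have hq2 : (q : ℂ × ℂ).2 ≠ 0 := h2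
    rw [e] at hq ⊢
    set U : ℂ × ℂ → ℝ := fun x => Real.log (‖x.1‖ / ‖(p : ℂ × ℂ).1‖)
    set W : ℂ × ℂ → ℝ := fun x => Real.log (‖x.2‖ / ‖(p : ℂ × ℂ).2‖)
    have hU : ContinuousAt U q :=
      ContinuousAt.log (by fun_prop) (div_ne_zero (norm_ne_zero_iff.2 hq1) (norm_ne_zero_iff.2 hp1))
    have hW : ContinuousAt W q :=
      ContinuousAt.log (by fun_prop) (div_ne_zero (norm_ne_zero_iff.2 hq2) (norm_ne_zero_iff.2 hp2))
    -- Off both circles the moduli give `Re z = W` and `Re (l z) = U`, from which `z` is recovered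
    -- since `l.im ≠ 0`.
    refine mem_of_mem_closure_range (continuous_linearFlow l p)
      (Z := fun x => (W x : ℂ) + ((l.re * W x - U x) / l.im : ℝ) * Complex.I) ?_ ?_ hq
    · exact (Complex.continuous_ofReal.continuousAt.comp hW).add
        ((Complex.continuous_ofReal.continuousAt.comp
          (((continuousAt_const.mul hW).sub hU).div_const _)).mul continuousAt_const)
    · intro z
      have eU : U (linearFlow l p z) = (l * z).re := by
        simp [U, linearFlow, Complex.norm_exp, hp1]
      have eW : W (linearFlow l p z) = z.re := by
        simp [W, linearFlow, Complex.norm_exp, hp2]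
      rw [eU, eW]
      apply Complex.ext
      · simp
      · simp
        field_simp
  · intro q hq
    refine Metric.mem_closure_iff.2 fun ε hε => ?_
    obtain ⟨z, hz1, hz2⟩ := exists_linearFlow_near_circleX hl hX hY (norm_snd_of_mem_circleX hq) hε
    refine ⟨⟨_, hz1⟩, by rw [e]; exact ⟨z, rfl⟩, ?_⟩
    rw [Subtype.dist_eq]
    convert hz2 using 2
    exact Prod.ext hq rfl
  · intro q hq
    refine Metric.mem_closure_iff.2 fun ε hε => ?_
    obtain ⟨z, hz1, hz2⟩ := exists_linearFlow_near_circleY hl hX hY (norm_fst_of_mem_circleY hq) hε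
    refine ⟨⟨_, hz1⟩, by rw [e]; exact ⟨z, rfl⟩, ?_⟩
    rw [Subtype.dist_eq]
    convert hz2 using 2
    exact Prod.ext rfl hq

theorem not_isClosed_traceLeaf_of_im_ne_zero {l : ℂ} (hl : l.im ≠ 0) {p : sphere3}
    (hX : p ∉ circleX) (hY : p ∉ circleY) : ¬ IsClosed (traceLeaf (linearField l) p) := by
  intro h
  have h1 := closure_traceLeaf_of_im_ne_zero hl hX hY
  obtain ⟨q, hq⟩ := circleX_nonempty
  rw [h.closure_eq] at h1
  have hm : q ∈ traceLeaf (linearField l) p := by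
    rw [h1]; exact Or.inr (Or.inl hq)
  exact (ne_zero_of_mem_leafIn_linearField hX hY hm).1 hq

/-! #### The resonant case -/

/-- The squared norm of `resonantFlow m p (s + t i)` as a function of `(t, s)`. -/
noncomputable def resonantNormSq (m : ℕ) (p : ℂ × ℂ) (v : ℝ × ℝ) : ℝ :=
  Real.exp (m * v.2) ^ 2 *
    ((p.1.re + ((p.2 ^ m).re * v.2 - (p.2 ^ m).im * v.1)) ^ 2 +
      (p.1.im + ((p.2 ^ m).re * v.1 + (p.2 ^ m).im * v.2)) ^ 2) +
  (‖p.2‖ * Real.exp v.2) ^ 2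

theorem resonantFlow_mem_sphere3 {m : ℕ} {p : ℂ × ℂ} {s t : ℝ} :
    resonantFlow m p ⟨s, t⟩ ∈ sphere3 ↔ resonantNormSq m p (t, s) = 1 := by
  change ‖_‖ ^ 2 + ‖_‖ ^ 2 = (1 : ℝ) ↔ _
  simp only [resonantFlow, norm_mul, Complex.norm_exp, mul_pow, resonantNormSq]
  rw [Complex.sq_norm (_ + _), Complex.normSq_apply]
  simp [← sq]

theorem contDiff_resonantNormSq (m : ℕ) (p : ℂ × ℂ) : ContDiff ℝ 1 (resonantNormSq m p) := by
  unfold resonantNormSq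
  fun_prop

theorem hasDerivAt_resonantNormSq (m : ℕ) (p : ℂ × ℂ) (t s : ℝ) :
    HasDerivAt (fun s => resonantNormSq m p (t, s))
      (2 * (m * (Real.exp (m * s) ^ 2 *
        ((p.1.re + ((p.2 ^ m).re * s - (p.2 ^ m).im * t)) ^ 2 +
          (p.1.im + ((p.2 ^ m).re * t + (p.2 ^ m).im * s)) ^ 2)) +
        Real.exp (m * s) ^ 2 * ((p.1.re + ((p.2 ^ m).re * s - (p.2 ^ m).im * t)) * (p.2 ^ m).re +
          (p.1.im + ((p.2 ^ m).re * t + (p.2 ^ m).im * s)) * (p.2 ^ m).im) +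
        (‖p.2‖ * Real.exp s) ^ 2)) s := by
  have hE : HasDerivAt (fun s : ℝ => Real.exp (m * s)) (Real.exp (m * s) * m) s := by
    simpa using ((hasDerivAt_id s).const_mul (m : ℝ)).exp
  have hX : HasDerivAt (fun s : ℝ => p.1.re + ((p.2 ^ m).re * s - (p.2 ^ m).im * t))
      ((p.2 ^ m).re) s := by
    simpa using (((hasDerivAt_id s).const_mul (p.2 ^ m).re).sub_const ((p.2 ^ m).im * t)).const_add p.1.re
  have hY : HasDerivAt (fun s : ℝ => p.1.im + ((p.2 ^ m).re * t + (p.2 ^ m).im * s))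
      ((p.2 ^ m).im) s := by
    simpa using (((hasDerivAt_id s).const_mul (p.2 ^ m).im).const_add ((p.2 ^ m).re * t)).const_add p.1.im
  have := ((hE.pow 2).mul ((hX.pow 2).add (hY.pow 2))).add
    (((Real.hasDerivAt_exp s).const_mul ‖p.2‖).pow 2)
  refine this.congr_deriv ?_
  simp only [Pi.pow_apply, Pi.add_apply]
  push_cast
  ring

/-- Transversality of orbits to the sphere in the direction of real time. On the sphere the
expression is at least `2 (1 + D)`, where the cross term satisfies `|D| ≤ |x| |y| ^ m ≤ |x| |y|`. -/
theorem deriv_resonantNormSq_pos {m : ℕ} (hm : 1 ≤ m) {p : ℂ × ℂ} (hp : p.2 ≠ 0) {t s : ℝ}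
    (h : resonantNormSq m p (t, s) = 1) :
    0 < 2 * (m * (Real.exp (m * s) ^ 2 *
        ((p.1.re + ((p.2 ^ m).re * s - (p.2 ^ m).im * t)) ^ 2 +
          (p.1.im + ((p.2 ^ m).re * t + (p.2 ^ m).im * s)) ^ 2)) +
        Real.exp (m * s) ^ 2 * ((p.1.re + ((p.2 ^ m).re * s - (p.2 ^ m).im * t)) * (p.2 ^ m).re +
          (p.1.im + ((p.2 ^ m).re * t + (p.2 ^ m).im * s)) * (p.2 ^ m).im) +
        (‖p.2‖ * Real.exp s) ^ 2) := by
  have hm' : (1 : ℝ) ≤ m := by exact_mod_cast hm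
  unfold resonantNormSq at h
  simp only at h
  have hc : (p.2 ^ m).re ^ 2 + (p.2 ^ m).im ^ 2 = (‖p.2‖ ^ m) ^ 2 := by
    rw [← norm_pow, Complex.sq_norm, Complex.normSq_apply]
    ring
  have hy : 0 < ‖p.2‖ * Real.exp s := mul_pos (norm_pos_iff.2 hp) (Real.exp_pos s)
  have hE : Real.exp (m * s) * ‖p.2‖ ^ m = (‖p.2‖ * Real.exp s) ^ m := by
    rw [mul_pow, ← Real.exp_nat_mul]
    ring
  set X := p.1.re + ((p.2 ^ m).re * s - (p.2 ^ m).im * t)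
  set Y := p.1.im + ((p.2 ^ m).re * t + (p.2 ^ m).im * s)
  set B := (p.2 ^ m).re
  set C := (p.2 ^ m).im
  set E := Real.exp (m * s)
  set y := ‖p.2‖ * Real.exp s
  have hx2 : 0 ≤ E ^ 2 * (X ^ 2 + Y ^ 2) := by positivity
  have hy1 : y ≤ 1 := by
    rw [← sq_le_one_iff₀ hy.le]
    linarith
  have hym : (y ^ m) ^ 2 ≤ y ^ 2 := by
    gcongr
    exact pow_le_of_le_one hy.le hy1 (by omega)
  have hD : (E ^ 2 * (X * B + Y * C)) ^ 2 ≤ E ^ 2 * (X ^ 2 + Y ^ 2) * y ^ 2 := by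
    calc (E ^ 2 * (X * B + Y * C)) ^ 2 = E ^ 4 * (X * B + Y * C) ^ 2 := by ring
      _ ≤ E ^ 4 * ((X ^ 2 + Y ^ 2) * (B ^ 2 + C ^ 2)) := by
          gcongr
          nlinarith [sq_nonneg (X * C - Y * B)]
      _ = E ^ 2 * (X ^ 2 + Y ^ 2) * (y ^ m) ^ 2 := by
          rw [hc, ← hE]
          ring
      _ ≤ E ^ 2 * (X ^ 2 + Y ^ 2) * y ^ 2 := by gcongr
  set x2 := E ^ 2 * (X ^ 2 + Y ^ 2)
  set D := E ^ 2 * (X * B + Y * C)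
  have hy2 : 0 < y ^ 2 := by positivity
  have hmx : x2 ≤ m * x2 := by nlinarith
  -- Otherwise `1 ≤ D² ≤ x2 * y²`, whereas `x2 + y² = 1` bounds the product by `1/4`.
  have : -1 < D := by
    by_contra hD1
    push Not at hD1
    nlinarith
  linarith

/-- A level crossed only upwards is crossed once. Between two crossings, comparison forwards from
`s₁` gives `g ≥ c` and backwards from `s₂` gives `g ≤ c`; then `g` is constant there, against the
positive derivative. -/
theorem eq_of_deriv_pos_on_level {g g' : ℝ → ℝ} {c : ℝ} (hg : ∀ s, HasDerivAt g (g' s) s)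
    (hpos : ∀ s, g s = c → 0 < g' s) {s₁ s₂ : ℝ} (h₁ : g s₁ = c) (h₂ : g s₂ = c) : s₁ = s₂ := by
  wlog hlt : s₁ < s₂ generalizing s₁ s₂
  · rcases lt_or_eq_of_le (not_lt.1 hlt) with h | h
    · exact (this h₂ h₁ h).symm
    · exact h.symm
  exfalso
  have hcont : Continuous g := continuous_iff_continuousAt.2 fun s => (hg s).continuousAt
  have hge : ∀ s ∈ Icc s₁ s₂, -g s ≤ -c := fun s hs =>
    image_le_of_deriv_right_lt_deriv_boundary (f := fun s => -g s) (f' := fun s => -g' s)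
      (B := fun _ => -c) (B' := fun _ => 0) hcont.neg.continuousOn
      (fun x _ => (hg x).neg.hasDerivWithinAt) (by simp [h₁]) (fun x => hasDerivAt_const x _)
      (fun x _ hx => neg_lt_zero.2 (hpos x (neg_injective hx))) hs
  have hr : ∀ x, HasDerivAt (fun s => g (-s)) (-g' (-x)) x := fun x => by
    exact ((hg (-x)).scomp x (hasDerivAt_neg x)).congr_deriv (by simp)
  have hle : ∀ s ∈ Icc (-s₂) (-s₁), g (-s) ≤ c := fun s hs =>
    image_le_of_deriv_right_lt_deriv_boundary (f := fun s => g (-s)) (f' := fun s => -g' (-s))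
      (B := fun _ => c) (B' := fun _ => 0) (hcont.comp continuous_neg).continuousOn
      (fun x _ => (hr x).hasDerivWithinAt) (by simp [h₂]) (fun x => hasDerivAt_const x _)
      (fun x _ hx => neg_lt_zero.2 (hpos _ hx)) hs
  have hall : ∀ s ∈ Icc s₁ s₂, g s = c := fun s hs => by
    have h1 := hge s hs
    have h2 := hle (-s) ⟨neg_le_neg hs.2, neg_le_neg hs.1⟩
    rw [neg_neg] at h2
    linarith
  have hmid : g =ᶠ[𝓝 ((s₁ + s₂) / 2)] fun _ => c := by
    filter_upwards [Icc_mem_nhds (by linarith : s₁ < (s₁ + s₂) / 2)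
      (by linarith : (s₁ + s₂) / 2 < s₂)] with s hs using hall s hs
  have h0 := (hg ((s₁ + s₂) / 2)).unique ((hasDerivAt_const _ c).congr_of_eventuallyEq hmid)
  exact (hpos _ (hall _ ⟨by linarith, by linarith⟩)).ne' h0

/-- As the level set is globally the graph of `σ`, the local implicit function must coincide with
`σ`. -/
theorem contDiff_of_forall_eq_iff {f : ℝ × ℝ → ℝ} (hf : ContDiff ℝ 1 f) {c : ℝ} {σ : ℝ → ℝ}
    (hσ : ∀ t x, f (t, x) = c ↔ x = σ t) {d : ℝ → ℝ}
    (hd : ∀ t, HasDerivAt (fun x => f (t, x)) (d t) (σ t)) (hd0 : ∀ t, d t ≠ 0) :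
    ContDiff ℝ 1 σ := by
  refine contDiff_iff_contDiffAt.2 fun t => ?_
  have cdf : ContDiffAt ℝ 1 f (t, σ t) := hf.contDiffAt
  have hval : (fderiv ℝ f (t, σ t) ∘L .inr ℝ ℝ ℝ) 1 = d t := by
    have h1 : HasFDerivAt f (fderiv ℝ f (t, σ t)) (t, σ t) :=
      (cdf.differentiableAt one_ne_zero).hasFDerivAt
    have h2 : HasDerivAt (fun x => (t, x)) ((0 : ℝ), (1 : ℝ)) (σ t) :=
      (hasDerivAt_const (σ t) t).prodMk (hasDerivAt_id (σ t))
    simpa using (h1.comp_hasDerivAt (σ t) h2).unique (hd t)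
  have if₂ : (fderiv ℝ f (t, σ t) ∘L .inr ℝ ℝ ℝ).IsInvertible := by
    refine ⟨ContinuousLinearEquiv.unitsEquivAut ℝ (Units.mk0 (d t) (hd0 t)), ?_⟩
    ext
    rw [hval]
    simp
  refine (cdf.contDiffAt_implicitFunction one_ne_zero if₂).congr_of_eventuallyEq ?_
  filter_upwards [cdf.eventually_apply_implicitFunction one_ne_zero if₂] with x hx
  exact ((hσ x _).1 (hx.trans ((hσ t _).2 rfl))).symm

theorem exists_resonantNormSq_eq_one {m : ℕ} (hm : 1 ≤ m) {p : ℂ × ℂ} (hp : p.2 ≠ 0) (t : ℝ) :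
    ∃ s, resonantNormSq m p (t, s) = 1 := by
  have hb := norm_pos_iff.2 hp
  have hcont : Continuous fun s => resonantNormSq m p (t, s) :=
    (contDiff_resonantNormSq m p).continuous.comp (by fun_prop)
  -- At this time the second coordinate alone has modulus `1`.
  have h1 : 1 ≤ resonantNormSq m p (t, -Real.log ‖p.2‖) := by
    unfold resonantNormSq
    simp only
    rw [Real.exp_neg, Real.exp_log hb, mul_inv_cancel₀ hb.ne', one_pow]
    have : ∀ x : ℝ, 0 ≤ x → 1 ≤ x + 1 := fun x hx => by linarith
    exact this _ (by positivity)
  have h2 : Tendsto (fun s : ℝ => resonantNormSq m p (t, -s)) atTop (𝓝 0) := by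
    have k1 := tendsto_exp_neg_nat_mul hm
    have k2 := tendsto_mul_exp_neg_nat_mul hm
    have k3 := (((k1.const_mul (p.1.re - (p.2 ^ m).im * t)).sub (k2.const_mul (p.2 ^ m).re)).pow
      2).add (((k1.const_mul (p.1.im + (p.2 ^ m).re * t)).sub (k2.const_mul (p.2 ^ m).im)).pow
      2) |>.add ((Real.tendsto_exp_neg_atTop_nhds_zero.const_mul ‖p.2‖).pow 2)
    simp only [mul_zero, sub_zero, ne_eq, OfNat.ofNat_ne_zero, not_false_eq_true, zero_pow,
      add_zero] at k3
    refine k3.congr fun s => ?_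
    simp only [resonantNormSq, mul_neg]
    ring
  obtain ⟨s, hs⟩ := (h2.eventually_le_const one_pos).exists
  exact mem_range_of_exists_le_of_exists_ge hcont ⟨-s, hs⟩ ⟨_, h1⟩

/-- For each imaginary part `t` exactly one real part `σ t` puts the flow on the sphere, and `σ` is
C¹; so the sphere times form one connected curve. -/
theorem traceLeaf_resonantField {m : ℕ} (hm : 1 ≤ m) {p : sphere3} (hY : p ∉ circleY) :
    traceLeaf (resonantField m) p = {q : sphere3 | ∃ z, (q : ℂ × ℂ) = resonantFlow m p z} := by
  have hp : (p : ℂ × ℂ).2 ≠ 0 := hY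
  choose σ hσ using exists_resonantNormSq_eq_one hm hp
  have hiff : ∀ t x, resonantNormSq m p (t, x) = 1 ↔ x = σ t := fun t x =>
    ⟨fun h => eq_of_deriv_pos_on_level (hasDerivAt_resonantNormSq m p t)
      (fun s hs => deriv_resonantNormSq_pos hm hp hs) h (hσ t), fun h => h ▸ hσ t⟩
  have hsm : ContDiff ℝ 1 σ := contDiff_of_forall_eq_iff (contDiff_resonantNormSq m p) hiff
    (fun t => hasDerivAt_resonantNormSq m p t (σ t))
    fun t => (deriv_resonantNormSq_pos hm hp (hσ t)).ne'
  have hζ : ContDiff ℝ 1 fun t => (⟨σ t, t⟩ : ℂ) := by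
    simp only [Complex.mk_eq_add_mul_I]
    exact (Complex.ofRealCLM.contDiff.comp hsm).add
      (Complex.ofRealCLM.contDiff.mul contDiff_const)
  have hz : ∀ z, resonantFlow m p z ∈ sphere3 → z = ⟨σ z.im, z.im⟩ := fun z h => by
    rw [← Complex.eta z, resonantFlow_mem_sphere3, hiff] at h
    exact Complex.ext h rfl
  ext q
  refine ⟨exists_resonantFlow_of_mem_leafIn, ?_⟩
  rintro ⟨z, hqz⟩
  have := mem_leafIn_of_flow (A := sphere3) (hasDerivAt_resonantFlow m p) hζ
    (fun t => resonantFlow_mem_sphere3.2 (hσ t)) 0 z.im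
  have h0 := hz 0 (by simp)
  rw [Complex.zero_im] at h0
  rwa [← hz z (hqz ▸ q.2), ← h0, resonantFlow_zero, ← hqz] at this

/-- Here the sphere equation is solved explicitly for the imaginary part `T` at real part `-s`. With
`c = p.2 ^ m`, the first coordinate is `c e^{i m T} (u + i r)`, where `u → 0` and `r → 1 / ‖c‖`; as
`m T → ∞`, its phase can be prescribed for arbitrarily large `s`. -/
theorem exists_resonantFlow_near_circleY {m : ℕ} (hm : 1 ≤ m) {p : ℂ × ℂ} (hp : p.2 ≠ 0) {x : ℂ}
    (hx : ‖x‖ = 1) {ε : ℝ} (hε : 0 < ε) :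
    ∃ z, resonantFlow m p z ∈ sphere3 ∧ dist (x, (0 : ℂ)) (resonantFlow m p z) < ε := by
  have hm' : (0 : ℝ) < m := by exact_mod_cast hm
  have hb := norm_pos_iff.2 hp
  have hc0 : p.2 ^ m ≠ 0 := pow_ne_zero m hp
  set c := p.2 ^ m with hc
  have hcn : 0 < ‖c‖ := norm_pos_iff.2 hc0
  set d := p.1 / c with hd
  set u : ℝ → ℝ := fun s => d.re * Real.exp (-(m * s)) - s * Real.exp (-(m * s)) with hu
  set k : ℝ → ℝ := fun s => (‖c‖ ^ 2)⁻¹ * (1 - (‖p.2‖ * Real.exp (-s)) ^ 2) - u s ^ 2 with hk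
  -- This root solves `‖c‖² (u² + r²) + |y|² = 1`. Where `k s` is negative it is `0` by convention,
  -- which is harmless because `k s > 0` for large `s`.
  set r : ℝ → ℝ := fun s => √(k s) with hr
  set T : ℝ → ℝ := fun s => Real.exp (m * s) * r s - d.im with hT
  have hulim : Tendsto u atTop (𝓝 0) := by
    simpa using ((tendsto_exp_neg_nat_mul hm).const_mul d.re).sub (tendsto_mul_exp_neg_nat_mul hm)
  have hylim : Tendsto (fun s => ‖p.2‖ * Real.exp (-s)) atTop (𝓝 0) := by
    simpa using Real.tendsto_exp_neg_atTop_nhds_zero.const_mul ‖p.2‖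
  have hklim : Tendsto k atTop (𝓝 (‖c‖ ^ 2)⁻¹) := by
    simpa using (((hylim.pow 2).const_sub 1).const_mul (‖c‖ ^ 2)⁻¹).sub (hulim.pow 2)
  have hrlim : Tendsto r atTop (𝓝 ‖c‖⁻¹) := by
    have := hklim.sqrt
    rwa [← inv_pow, Real.sqrt_sq (by positivity)] at this
  have hTlim : Tendsto (fun s => m * T s) atTop atTop := by
    refine Tendsto.const_mul_atTop hm' (tendsto_atTop_add_const_right _ _ ?_)
    exact (Real.tendsto_exp_atTop.comp (tendsto_id.const_mul_atTop hm')).atTop_mul_pos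
      (inv_pos.2 hcn) hrlim
  have hTc : Continuous fun s => m * T s := by
    simp only [hT, hr, hk, hu]
    fun_prop
  obtain ⟨α, hα⟩ := exists_eq_mul_cexp_I (c := x) (a := c * ((‖c‖⁻¹ : ℝ) * Complex.I))
    (by simp [hx, hc0])
  have hxlim : Tendsto (fun s => ‖c * Complex.exp (α * Complex.I) * (u s + r s * Complex.I) - x‖)
      atTop (𝓝 0) := by
    have h1 := (Complex.continuous_ofReal.tendsto _).comp hulim
    have h2 := (Complex.continuous_ofReal.tendsto _).comp hrlim
    have h3 := ((h1.add (h2.mul_const Complex.I)).const_mul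
      (c * Complex.exp (α * Complex.I))).sub_const x
    have h4 : c * Complex.exp (α * Complex.I) * (((0 : ℝ) : ℂ) + (‖c‖⁻¹ : ℝ) * Complex.I) - x = 0 := by
      conv_lhs => rw [hα]
      push_cast
      ring
    rw [h4] at h3
    simpa using h3.norm
  obtain ⟨s, ⟨n, hn⟩, ⟨hs1, hs2⟩, hs3⟩ :=
    ((frequently_eq_add_int_mul hTc (Or.inl hTlim) α).and_eventually
      (((hxlim.eventually_lt_const hε).and (hylim.eventually_lt_const hε)).and
        (hklim.eventually_const_lt (by positivity : 0 < (‖c‖ ^ 2)⁻¹)))).exists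
  have e1 : (resonantFlow m p ⟨-s, T s⟩).1 =
      c * Complex.exp (α * Complex.I) * (u s + r s * Complex.I) := by
    have hexp : Complex.exp (m * (⟨-s, T s⟩ : ℂ)) =
        (Real.exp (-(m * s)) : ℂ) * Complex.exp (α * Complex.I) := by
      rw [Complex.ofReal_exp, ← Complex.exp_add, Complex.exp_eq_exp_iff_exists_int]
      refine ⟨n, ?_⟩
      have hn' : (m : ℂ) * (T s : ℂ) = α + n * (2 * Real.pi) := by exact_mod_cast hn
      rw [Complex.mk_eq_add_mul_I]
      push_cast
      linear_combination Complex.I * hn'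
    have hlin : p.1 + c * (⟨-s, T s⟩ : ℂ) =
        c * ((d.re - s : ℝ) + (Real.exp (m * s) * r s : ℝ) * Complex.I) := by
      have e2 : p.1 = c * d := by rw [hd, mul_div_cancel₀ _ hc0]
      have e3 : d + (⟨-s, T s⟩ : ℂ) =
          ((d.re - s : ℝ) + (Real.exp (m * s) * r s : ℝ) * Complex.I) := by
        rw [Complex.mk_eq_add_mul_I]
        conv_lhs => rw [← Complex.re_add_im d]
        simp only [hT]
        push_cast
        ring
      rw [e2, ← mul_add, e3]
    have hee : (Real.exp (-(m * s)) : ℂ) * (Real.exp (m * s) : ℂ) = 1 := by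
      rw [← Complex.ofReal_mul, ← Real.exp_add]
      simp
    change Complex.exp (m * (⟨-s, T s⟩ : ℂ)) * (p.1 + c * (⟨-s, T s⟩ : ℂ)) = _
    rw [hexp, hlin]
    simp only [hu]
    push_cast at hee ⊢
    linear_combination (Complex.exp (α * Complex.I) * c * r s * Complex.I) * hee
  have e2 : ‖(resonantFlow m p ⟨-s, T s⟩).2‖ = ‖p.2‖ * Real.exp (-s) := by
    simp [resonantFlow, Complex.norm_exp]
  refine ⟨⟨-s, T s⟩, ?_, ?_⟩
  · change ‖_‖ ^ 2 + ‖_‖ ^ 2 = (1 : ℝ)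
    rw [e1, e2, norm_mul, norm_mul_cexp_I, mul_pow, Complex.sq_norm (_ + _), Complex.normSq_add_mul_I,
      Real.sq_sqrt hs3.le]
    simp only [hk]
    field_simp
    ring
  · rw [dist_comm, Prod.dist_eq]
    refine max_lt ?_ ?_
    · rw [dist_eq_norm, e1]
      exact hs1
    · rw [dist_zero_right, e2]
      exact hs2

theorem traceLeaf_resonantField_circleY {m : ℕ} (hm : 1 ≤ m) {p : sphere3} (hp : p ∈ circleY) :
    traceLeaf (resonantField m) p = circleY := by
  have hm0 : (m : ℂ) ≠ 0 := by exact_mod_cast (by omega : m ≠ 0)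
  rw [← traceLeaf_linearField_circleY hm0 hp]
  unfold traceLeaf
  rw [leafIn_resonantField_eq hm hp]

theorem closure_traceLeaf_resonantField {m : ℕ} (hm : 1 ≤ m) {p : sphere3} (hY : p ∉ circleY) :
    closure (traceLeaf (resonantField m) p) = traceLeaf (resonantField m) p ∪ circleY := by
  have hp : (p : ℂ × ℂ).2 ≠ 0 := hY
  have e := traceLeaf_resonantField hm hY
  refine Subset.antisymm ?_ (union_subset subset_closure ?_)
  · intro q hq
    by_cases h : q ∈ circleY
    · exact Or.inr h
    refine Or.inl ?_
    have hq2 : (q : ℂ × ℂ).2 ≠ 0 := h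
    rw [e] at hq ⊢
    -- Along the flow `x / y ^ m` increases by exactly the elapsed time, so it serves as a clock off
    -- `y = 0`.
    refine mem_of_mem_closure_range (continuous_resonantFlow m p)
      (Z := fun x => x.1 / x.2 ^ m - (p : ℂ × ℂ).1 / (p : ℂ × ℂ).2 ^ m) ?_ ?_ hq
    · exact (continuousAt_fst.div (continuousAt_snd.pow m) (pow_ne_zero m hq2)).sub
        continuousAt_const
    · intro z
      simp only [resonantFlow, mul_pow, ← Complex.exp_nat_mul]
      have := Complex.exp_ne_zero (m * z)
      field_simp
      ring
  · intro q hq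
    refine Metric.mem_closure_iff.2 fun ε hε => ?_
    obtain ⟨z, hz1, hz2⟩ := exists_resonantFlow_near_circleY hm hp (norm_fst_of_mem_circleY hq) hε
    refine ⟨⟨_, hz1⟩, by rw [e]; exact ⟨z, rfl⟩, ?_⟩
    rw [Subtype.dist_eq]
    convert hz2 using 2
    exact Prod.ext rfl hq

theorem not_isClosed_traceLeaf_resonantField {m : ℕ} (hm : 1 ≤ m) {p : sphere3}
    (hY : p ∉ circleY) : ¬ IsClosed (traceLeaf (resonantField m) p) := by
  intro h
  have h1 := closure_traceLeaf_resonantField hm hY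
  obtain ⟨q, hq⟩ := circleY_nonempty
  rw [h.closure_eq] at h1
  have hm : q ∈ traceLeaf (resonantField m) p := by
    rw [h1]; exact Or.inr hq
  obtain ⟨z, hz⟩ := exists_resonantFlow_of_mem_leafIn hm
  have h2 : (q : ℂ × ℂ).2 = 0 := hq
  rw [hz] at h2
  exact mul_ne_zero hY (Complex.exp_ne_zero z) h2

theorem closedTraceLeaves_resonantField {m : ℕ} (hm : 1 ≤ m) :
    closedTraceLeaves (resonantField m) = {circleY} := by
  ext L
  rw [mem_singleton_iff]
  constructor
  · rintro ⟨⟨p, rfl⟩, hc⟩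
    by_cases h : p ∈ circleY
    · exact traceLeaf_resonantField_circleY hm h
    · exact absurd hc (not_isClosed_traceLeaf_resonantField hm h)
  · rintro rfl
    obtain ⟨p, hp⟩ := circleY_nonempty
    exact ⟨⟨p, traceLeaf_resonantField_circleY hm hp⟩, isClosed_circleY⟩

/-! ### Trace foliations in different cases are not equivalent -/

theorem traceLeaves_nonReal {θ : ℂ × ℂ → ℂ × ℂ} (hθ : θ ∈ PoincareCase.nonReal.normalForms) :
    closedTraceLeaves θ = {circleX, circleY} ∧
      ∀ p : sphere3, p ∉ circleX → p ∉ circleY →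
        closure (traceLeaf θ p) = traceLeaf θ p ∪ (circleX ∪ circleY) := by
  obtain ⟨l, hl, rfl⟩ := hθ
  have hl0 : l ≠ 0 := fun h => hl (by simp [h])
  exact ⟨closedTraceLeaves_eq_pair (fun _ => traceLeaf_linearField_circleX l)
    (fun _ => traceLeaf_linearField_circleY hl0)
    fun _ => not_isClosed_traceLeaf_of_im_ne_zero hl,
    fun _ => closure_traceLeaf_of_im_ne_zero hl⟩

theorem traceLeaves_resonant {θ : ℂ × ℂ → ℂ × ℂ} (hθ : θ ∈ PoincareCase.resonant.normalForms) :
    closedTraceLeaves θ = {circleY} ∧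
      ∀ p : sphere3, p ∉ circleY → closure (traceLeaf θ p) = traceLeaf θ p ∪ circleY := by
  obtain ⟨m, hm, rfl⟩ := hθ
  exact ⟨closedTraceLeaves_resonantField hm, fun _ => closure_traceLeaf_resonantField hm⟩

theorem traceLeaves_rational {θ : ℂ × ℂ → ℂ × ℂ} (hθ : θ ∈ PoincareCase.rational.normalForms)
    (p : sphere3) : IsClosed (traceLeaf θ p) := by
  obtain ⟨r, hr, rfl⟩ := hθ
  exact isClosed_traceLeaf_of_rational hr p

theorem traceLeaves_irrational {θ : ℂ × ℂ → ℂ × ℂ}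
    (hθ : θ ∈ PoincareCase.irrational.normalForms) :
    closedTraceLeaves θ = {circleX, circleY} ∧
      ∀ p : sphere3, p ∉ circleX → p ∉ circleY →
        closure (traceLeaf θ p) = {q : sphere3 | ‖(q : ℂ × ℂ).1‖ = ‖(p : ℂ × ℂ).1‖} := by
  obtain ⟨l, hl0, hl, rfl⟩ := hθ
  have hl1 : (l : ℂ) ≠ 0 := by exact_mod_cast hl0.ne'
  exact ⟨closedTraceLeaves_eq_pair (fun _ => traceLeaf_linearField_circleX l)
    (fun _ => traceLeaf_linearField_circleY hl1)
    fun _ => not_isClosed_traceLeaf_of_irrational hl0 hl,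
    fun p _ _ => closure_traceLeaf_of_irrational hl0 hl p⟩

theorem circleX_ne_circleY : circleX ≠ circleY := by
  intro h
  obtain ⟨p, hp⟩ := circleX_nonempty
  have h1 : (p : ℂ × ℂ).2 = 0 := (h ▸ hp : p ∈ circleY)
  simpa [h1] using norm_snd_of_mem_circleX hp

theorem exists_notMem_circles : ∃ p : sphere3, p ∉ circleX ∧ p ∉ circleY := by
  refine ⟨⟨((3 / 5 : ℝ), (4 / 5 : ℝ)), ?_⟩, fun h => ?_, fun h => ?_⟩
  · change ‖_‖ ^ 2 + ‖_‖ ^ 2 = (1 : ℝ)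
    rw [Complex.norm_real, Complex.norm_real]
    norm_num
  · have : ((3 / 5 : ℝ) : ℂ) = 0 := h
    norm_num at this
  · have : ((4 / 5 : ℝ) : ℂ) = 0 := h
    norm_num at this

/-! ### Invariants of trace foliations under homeomorphisms of the sphere. -/

theorem TraceEquiv.symm {θ η : ℂ × ℂ → ℂ × ℂ} (h : TraceEquiv θ η) : TraceEquiv η θ := by
  obtain ⟨φ, hφ⟩ := h
  refine ⟨φ.symm, fun p => ?_⟩
  have := hφ (φ.symm p)
  rw [φ.apply_symm_apply] at this
  rw [← this, image_image]
  simp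

theorem TraceEquiv.allClosed {θ η : ℂ × ℂ → ℂ × ℂ} (h : TraceEquiv θ η)
    (hη : ∀ p, IsClosed (traceLeaf η p)) (p : sphere3) : IsClosed (traceLeaf θ p) := by
  obtain ⟨φ, hφ⟩ := h
  rw [← φ.isClosed_image, hφ]
  exact hη _

theorem TraceEquiv.closedTraceLeaves_eq {θ η : ℂ × ℂ → ℂ × ℂ} {φ : sphere3 ≃ₜ sphere3}
    (hφ : ∀ p, φ '' traceLeaf θ p = traceLeaf η (φ p)) :
    closedTraceLeaves η = (φ '' ·) '' closedTraceLeaves θ := by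
  ext L
  constructor
  · rintro ⟨⟨p, rfl⟩, hc⟩
    have h1 := hφ (φ.symm p)
    rw [φ.apply_symm_apply] at h1
    exact ⟨_, ⟨⟨φ.symm p, rfl⟩, by rwa [← φ.isClosed_image, h1]⟩, h1⟩
  · rintro ⟨_, ⟨⟨p, rfl⟩, hc⟩, rfl⟩
    exact ⟨⟨φ p, (hφ p).symm⟩, φ.isClosed_image.2 hc⟩

theorem TraceEquiv.ncard_eq {θ η : ℂ × ℂ → ℂ × ℂ} (h : TraceEquiv θ η) :
    (closedTraceLeaves θ).ncard = (closedTraceLeaves η).ncard := by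
  obtain ⟨φ, hφ⟩ := h
  rw [TraceEquiv.closedTraceLeaves_eq hφ]
  exact (ncard_image_of_injective _ φ.injective.image_injective).symm

theorem not_isClosed_of_closedTraceLeaves {θ : ℂ × ℂ → ℂ × ℂ}
    (h : closedTraceLeaves θ ⊆ {circleX, circleY}) : ¬ ∀ p, IsClosed (traceLeaf θ p) := by
  intro ha
  obtain ⟨p, hX, hY⟩ := exists_notMem_circles
  have hp : p ∈ traceLeaf θ p := mem_leafIn_self p.2
  rcases h ⟨⟨p, rfl⟩, ha p⟩ with h1 | h1
  · exact hX (h1 ▸ hp)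
  · exact hY (h1 ▸ hp)

/-- The closure of every trace leaf contains a closed trace leaf. -/
def TraceClosuresMeet (θ : ℂ × ℂ → ℂ × ℂ) : Prop :=
  ∀ p, ∃ L ∈ closedTraceLeaves θ, L ⊆ closure (traceLeaf θ p)

theorem TraceEquiv.traceClosuresMeet {θ η : ℂ × ℂ → ℂ × ℂ} (h : TraceEquiv θ η)
    (hθ : TraceClosuresMeet θ) : TraceClosuresMeet η := by
  obtain ⟨φ, hφ⟩ := h
  intro p
  obtain ⟨L, hL, hc⟩ := hθ (φ.symm p)
  refine ⟨φ '' L, ?_, ?_⟩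
  · rw [TraceEquiv.closedTraceLeaves_eq hφ]
    exact ⟨L, hL, rfl⟩
  · have h1 := image_mono (f := φ) hc
    rwa [φ.image_closure, hφ, φ.apply_symm_apply] at h1

theorem traceClosuresMeet_nonReal {θ : ℂ × ℂ → ℂ × ℂ}
    (hθ : θ ∈ PoincareCase.nonReal.normalForms) : TraceClosuresMeet θ := by
  obtain ⟨h1, h2⟩ := traceLeaves_nonReal hθ
  intro p
  by_cases hc : IsClosed (traceLeaf θ p)
  · exact ⟨_, ⟨⟨p, rfl⟩, hc⟩, subset_closure⟩
  obtain ⟨l, hl, rfl⟩ := hθ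
  have hl0 : l ≠ 0 := fun h => hl (by simp [h])
  have hX : p ∉ circleX := fun h => hc (by
    rw [traceLeaf_linearField_circleX l h]; exact isClosed_circleX)
  have hY : p ∉ circleY := fun h => hc (by
    rw [traceLeaf_linearField_circleY hl0 h]; exact isClosed_circleY)
  refine ⟨circleX, by rw [h1]; exact Or.inl rfl, ?_⟩
  rw [h2 p hX hY]
  exact fun q hq => Or.inr (Or.inl hq)

/-- A torus `|x| = |a|` with `0 < |a| < 1` contains neither circle. -/
theorem not_traceClosuresMeet_irrational {θ : ℂ × ℂ → ℂ × ℂ}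
    (hθ : θ ∈ PoincareCase.irrational.normalForms) : ¬ TraceClosuresMeet θ := by
  obtain ⟨h1, h2⟩ := traceLeaves_irrational hθ
  intro h
  obtain ⟨p, hX, hY⟩ := exists_notMem_circles
  obtain ⟨L, hL, hc⟩ := h p
  rw [h1] at hL
  rw [h2 p hX hY] at hc
  rcases hL with rfl | rfl
  · obtain ⟨q, hq⟩ := circleX_nonempty
    have h3 : ‖(q : ℂ × ℂ).1‖ = ‖(p : ℂ × ℂ).1‖ := hc hq
    rw [show (q : ℂ × ℂ).1 = 0 from hq, norm_zero, eq_comm, norm_eq_zero] at h3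
    exact hX h3
  · obtain ⟨q, hq⟩ := circleY_nonempty
    have h3 : ‖(q : ℂ × ℂ).1‖ = ‖(p : ℂ × ℂ).1‖ := hc hq
    rw [norm_fst_of_mem_circleY hq] at h3
    have h4 := sphere3_eq p
    rw [← h3] at h4
    refine hY (norm_eq_zero.1 (pow_eq_zero_iff two_ne_zero |>.1 ?_))
    linarith

/-- Closedness of all leaves singles out the rational case, a single closed leaf the resonant one,
and `TraceClosuresMeet` separates non-real from irrational. -/
theorem not_traceEquiv_of_ne {i j : PoincareCase} (hij : i ≠ j) {θ η : ℂ × ℂ → ℂ × ℂ}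
    (hθ : θ ∈ i.normalForms) (hη : η ∈ j.normalForms) : ¬ TraceEquiv θ η := by
  have nonReal : ∀ {θ : ℂ × ℂ → ℂ × ℂ}, θ ∈ PoincareCase.nonReal.normalForms →
      (¬ ∀ p, IsClosed (traceLeaf θ p)) ∧ ¬ (closedTraceLeaves θ).ncard = 1 ∧
        TraceClosuresMeet θ := fun hθ => by
    have h := (traceLeaves_nonReal hθ).1
    refine ⟨not_isClosed_of_closedTraceLeaves h.subset, ?_, traceClosuresMeet_nonReal hθ⟩
    rw [h, ncard_pair circleX_ne_circleY]
    norm_num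
  have resonant : ∀ {θ : ℂ × ℂ → ℂ × ℂ}, θ ∈ PoincareCase.resonant.normalForms →
      (¬ ∀ p, IsClosed (traceLeaf θ p)) ∧ (closedTraceLeaves θ).ncard = 1 := fun hθ => by
    have h := (traceLeaves_resonant hθ).1
    refine ⟨not_isClosed_of_closedTraceLeaves (h.subset.trans (subset_insert _ _)), ?_⟩
    rw [h, ncard_singleton]
  have irrational : ∀ {θ : ℂ × ℂ → ℂ × ℂ}, θ ∈ PoincareCase.irrational.normalForms →
      (¬ ∀ p, IsClosed (traceLeaf θ p)) ∧ ¬ (closedTraceLeaves θ).ncard = 1 ∧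
        ¬ TraceClosuresMeet θ := fun hθ => by
    have h := (traceLeaves_irrational hθ).1
    refine ⟨not_isClosed_of_closedTraceLeaves h.subset, ?_, not_traceClosuresMeet_irrational hθ⟩
    rw [h, ncard_pair circleX_ne_circleY]
    norm_num
  intro h
  have e1 : (∀ p, IsClosed (traceLeaf θ p)) ↔ ∀ p, IsClosed (traceLeaf η p) :=
    ⟨h.symm.allClosed, h.allClosed⟩
  have e2 : (closedTraceLeaves θ).ncard = 1 ↔ (closedTraceLeaves η).ncard = 1 := by rw [h.ncard_eq]
  have e3 : TraceClosuresMeet θ ↔ TraceClosuresMeet η :=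
    ⟨h.traceClosuresMeet, h.symm.traceClosuresMeet⟩
  cases i <;> cases j <;> first
    | exact hij rfl
    | (first
        | have a := nonReal hθ
        | have a := resonant hθ
        | have a := traceLeaves_rational hθ
        | have a := irrational hθ
       first
        | have b := nonReal hη
        | have b := resonant hη
        | have b := traceLeaves_rational hη
        | have b := irrational hη
       tauto)

theorem mainTheorem5 :
    -- germs in different cases are not topologically equivalent
    (∀ (i j : PoincareCase), i ≠ j → ∀ (F G : PlaneGerm), F.InCase i → G.InCase j →
      ¬ F.TopEquiv G) ∧
    -- neither are their trace foliations
    (∀ (i j : PoincareCase), i ≠ j → ∀ θ ∈ i.normalForms, ∀ η ∈ j.normalForms,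
      ¬ TraceEquiv θ η) ∧
    -- closed leaves and leaf closures of the trace foliation in each of the four cases
    (∀ θ ∈ PoincareCase.nonReal.normalForms,
      closedTraceLeaves θ = {circleX, circleY} ∧
      ∀ p : sphere3, p ∉ circleX → p ∉ circleY →
        closure (traceLeaf θ p) = traceLeaf θ p ∪ (circleX ∪ circleY)) ∧
    (∀ θ ∈ PoincareCase.resonant.normalForms,
      closedTraceLeaves θ = {circleY} ∧
      ∀ p : sphere3, p ∉ circleY → closure (traceLeaf θ p) = traceLeaf θ p ∪ circleY) ∧
    (∀ θ ∈ PoincareCase.rational.normalForms, ∀ p : sphere3, IsClosed (traceLeaf θ p)) ∧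
    (∀ θ ∈ PoincareCase.irrational.normalForms,
      closedTraceLeaves θ = {circleX, circleY} ∧
      ∀ p : sphere3, p ∉ circleX → p ∉ circleY →
        closure (traceLeaf θ p) = {q : sphere3 | ‖(q : ℂ × ℂ).1‖ = ‖(p : ℂ × ℂ).1‖}) :=
  ⟨fun _ _ hij _ _ => not_topEquiv_of_ne hij, fun _ _ hij _ hθ _ => not_traceEquiv_of_ne hij hθ,
    fun _ => traceLeaves_nonReal, fun _ => traceLeaves_resonant, fun _ => traceLeaves_rational,
    fun _ => traceLeaves_irrational⟩
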